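/- Let $(G,\Lambda_G)$ be a Lie–Poisson group (a finite-dimensional real Lie group with a smooth Poisson tensor for which the multiplication is a Poisson map), and let $(G^*,\Lambda_{G^*})$ be its dual Lie–Poisson group, with $G^*$ connected. Let $D=D(G,\Lambda_G)$ be a group double: a Lie group containing $G$ and $G^*$ as Lie subgroups, whose Lie algebra $\mathfrak d$ carries an $\mathrm{Ad}_D$-invariant nondegenerate symmetric bilinear form $\langle\cdot,\cdot\rangle$ such that $\mathfrak d=\mathfrak g\oplus\mathfrak g^*$ with $\mathfrak g=\mathrm{Lie}(G)$, $\mathfrak g^*=\mathrm{Lie}(G^*)$ both isotropic, and such that, under the resulting duality, the linearization of $\Lambda_G$ at the unit is the bracket of $\mathfrak g^*$ and the linearization of $\Lambda_{G^*}$ at the unit is the bracket of $\mathfrak g$. Let $X_i$, $Y_i$ be dual bases of $\mathfrak g$ and $\mathfrak g^*$, and let $X^l$, $Y^r$ denote the left-invariant vector field on $G$ and the right-invariant vector field on $G^*$ given by $X\in\mathfrak g$, $Y\in\mathfrak g^*$. The Poisson tensor of the double is $\Lambda_D^+=\tfrac12(r^l+r^r)$, where $r^l$, $r^r$ are the left-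 and right-invariant bivector fields on $D$ with value $r=\sum_i (Y_i\otimes X_i-X_i\otimes Y_i)$ at the unit; for a bivector $\Lambda$ and a 1-form $\theta$ we write $\Lambda(\theta)=\Lambda(\theta,\cdot)$. Assume that $D$ is complete: $G\cdot G^*\cap G^*\cdot G=D$ and every $d\in D$ has a unique factorization $d=gu$ with $g\in G$, $u\in G^*$. Let $\mu_{G^*}:D\to G^*$, $gu\mapsto u$. Let $\eta$ be a 1-form on $G^*$ which is a Casimir for $\Lambda_{G^*}$, that is, $\Lambda_{G^*}(\eta)=0$, and put $\Gamma_\eta=\Lambda_D^+(\mu_{G^*}^*\eta)$ and $L_\eta(u)=\sum_i\langle Y_i^r,\eta\rangle(u)\,X_i\in\mathfrak g$. **Theorem 1.** $(g,u)$ are smooth coordinates on $D$, in which $\Gamma_\eta(g,u)=\sum_i\langle Y_i^r,\eta\rangle(u)\,X_i^l(g)$; that is, the dynamics of $\Gamma_\eta$ is given by the equations $$\dot u=0,\qquad g^{-1}\dot g=L_\eta(u)=\sum_i\langle Y_i^r,\eta\rangle(u)\,X_i\in\mathfrak g .$$ Consequently the system is integrable by quadratures, in the sense that on each level set of $u$ its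 flow is the left-invariant flow of a one-parameter subgroup of $G$: for all $g_0\in G$, $u_0\in G^*$, the curve $t\mapsto g_0\exp(tL_\eta(u_0))\,u_0$ is an integral curve of $\Gamma_\eta$, defined for all $t\in\mathbb R$, and every integral curve on an open interval around $0$ which starts at $g_0u_0$ at time $0$ is a restriction of it. -/

import Mathlib

open scoped Manifold ContDiff

noncomputable section

namespace PoissonDouble

section Basic

variable {E : Type*} [NormedAddCommGroup E] [NormedSpace ℝ E]
variable {M : Type*} [TopologicalSpace M] [ChartedSpace E M]

/-- The tangent space `T_x M`. -/
abbrev Tan (E : Type*) [NormedAddCommGroup E] [NormedSpace ℝ E]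
    {M : Type*} [TopologicalSpace M] [ChartedSpace E M] (x : M) : Type _ :=
  TangentSpace 𝓘(ℝ, E) x

/-- The cotangent space `T_x^* M`. -/
abbrev Cotan (E : Type*) [NormedAddCommGroup E] [NormedSpace ℝ E]
    {M : Type*} [TopologicalSpace M] [ChartedSpace E M] (x : M) : Type _ :=
  Tan E x →L[ℝ] ℝ

/-- A field of contravariant 2-tensors `Λ` on `M`, given by `α ↦ Λ(α) = Λ(α, ·)`, so that
`β (Λ x α) = Λ(α, β)`. -/
abbrev TensorField (E : Type*) [NormedAddCommGroup E] [NormedSpace ℝ E]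
    (M : Type*) [TopologicalSpace M] [ChartedSpace E M] : Type _ :=
  ∀ x : M, Cotan E x →ₗ[ℝ] Tan E x

/-- The differential `df` of a real function. -/
def differential (f : M → ℝ) (x : M) : Cotan E x := mfderiv 𝓘(ℝ, E) 𝓘(ℝ, ℝ) f x

/-- The bracket `{f, h} = Λ(df, dh)`. -/
def bracket (Λ : TensorField E M) (f h : M → ℝ) (x : M) : ℝ :=
  differential (E := E) h x (Λ x (differential f x))

/-- A 1-form `η` is a Casimir of `Λ` when `Λ(η) = 0`. -/
def IsCasimir (Λ : TensorField E M) (η : ∀ x : M, Cotan E x) : Prop :=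
  ∀ x, Λ x (η x) = 0

end Basic

section Group

variable {E : Type*} [NormedAddCommGroup E] [NormedSpace ℝ E]
variable {G : Type*} [TopologicalSpace G] [ChartedSpace E G] [Group G]

/-- The Lie algebra of `G` (with the bracket of left-invariant vector fields). -/
abbrev LieAlg (E : Type*) [NormedAddCommGroup E] [NormedSpace ℝ E]
    (G : Type*) [TopologicalSpace G] [ChartedSpace E G] [Group G] : Type _ :=
  GroupLieAlgebra 𝓘(ℝ, E) G

/-- The differential at `1` of `x ↦ g x`; thus `leftTr g X = X^l(g)`, the value at `g` of the
left-invariant vector field of `X`. -/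
def leftTr (g : G) : LieAlg E G →L[ℝ] Tan E g :=
  mfderiv 𝓘(ℝ, E) 𝓘(ℝ, E) (fun x : G => g * x) 1

/-- The differential at `1` of `x ↦ x g`; thus `rightTr g X = X^r(g)`, the value at `g` of the
right-invariant vector field of `X`. -/
def rightTr (g : G) : LieAlg E G →L[ℝ] Tan E g :=
  mfderiv 𝓘(ℝ, E) 𝓘(ℝ, E) (fun x : G => x * g) 1

/-- The differential at `g` of `x ↦ x g⁻¹`, from `T_g G` to the Lie algebra. -/
def rightTrInv (g : G) : Tan E g →L[ℝ] LieAlg E G :=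
  mfderiv 𝓘(ℝ, E) 𝓘(ℝ, E) (fun x : G => x * g⁻¹) g

/-- The adjoint action `Ad_g`, the differential at `1` of `x ↦ g x g⁻¹`. -/
def Ad (g : G) : LieAlg E G →L[ℝ] LieAlg E G :=
  mfderiv 𝓘(ℝ, E) 𝓘(ℝ, E) (fun x : G => g * x * g⁻¹) 1

/-- The function `g ↦ Λ(α^r, β^r)(g)`, where `α^r`, `β^r` are the right-invariant 1-forms with
values `α`, `β` at `1`. -/
def rightTriv (Λ : TensorField E G) (α β : Cotan E (1 : G)) (g : G) : ℝ :=
  (β.comp (rightTrInv g)) (Λ g (α.comp (rightTrInv g)))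

/-- The linearization at the unit of a tensor vanishing there:
`(d_1 Λ)(x)(α, β)`, the derivative at `1` in the direction `x` of `g ↦ Λ(α^r, β^r)(g)`. -/
def linearization (Λ : TensorField E G) (x : LieAlg E G) (α β : Cotan E (1 : G)) : ℝ :=
  differential (E := E) (rightTriv Λ α β) 1 x

/-- A Lie–Poisson (Poisson–Lie) structure on a Lie group: a smooth Poisson tensor for which the
multiplication `G × G → G` is a Poisson map. -/
structure IsLiePoisson (Λ : TensorField E G) : Prop where
  skew : ∀ (g : G) (α β : Cotan E g), β (Λ g α) = -α (Λ g β)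
  smooth : ∀ α β : Cotan E (1 : G), ContMDiff 𝓘(ℝ, E) 𝓘(ℝ, ℝ) ∞ (rightTriv Λ α β)
  jacobi : ∀ f h k : G → ℝ, ContMDiff 𝓘(ℝ, E) 𝓘(ℝ, ℝ) ∞ f →
    ContMDiff 𝓘(ℝ, E) 𝓘(ℝ, ℝ) ∞ h → ContMDiff 𝓘(ℝ, E) 𝓘(ℝ, ℝ) ∞ k → ∀ g : G,
    bracket Λ f (bracket Λ h k) g + bracket Λ h (bracket Λ k f) g +
      bracket Λ k (bracket Λ f h) g = 0
  multiplicative : ∀ (g h : G) (α β : Cotan E (g * h)),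
    β (Λ (g * h) α) =
      (β.comp (mfderiv 𝓘(ℝ, E) 𝓘(ℝ, E) (fun x : G => g * x) h))
        (Λ h (α.comp (mfderiv 𝓘(ℝ, E) 𝓘(ℝ, E) (fun x : G => g * x) h))) +
      (β.comp (mfderiv 𝓘(ℝ, E) 𝓘(ℝ, E) (fun x : G => x * h) g))
        (Λ g (α.comp (mfderiv 𝓘(ℝ, E) 𝓘(ℝ, E) (fun x : G => x * h) g)))

/-- `γ` is the one-parameter subgroup `t ↦ exp (t ξ)` of `G`. -/
structure IsOneParameterSubgroup (γ : ℝ → G) (ξ : LieAlg E G) : Prop where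
  map_zero : γ 0 = 1
  map_add : ∀ s t : ℝ, γ (s + t) = γ s * γ t
  /-- `γ' t = ξ^l (γ t)`, in particular `γ' 0 = ξ`. -/
  hasMFDerivAt : ∀ t : ℝ, HasMFDerivAt 𝓘(ℝ, ℝ) 𝓘(ℝ, E) γ t
    ((1 : ℝ →L[ℝ] ℝ).smulRight (leftTr (γ t) ξ))

end Group

section Double

variable {E F V : Type*}
  [NormedAddCommGroup E] [NormedSpace ℝ E]
  [NormedAddCommGroup F] [NormedSpace ℝ F]
  [NormedAddCommGroup V] [NormedSpace ℝ V]
  {G H : Type*}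
  [TopologicalSpace G] [ChartedSpace E G] [Group G]
  [TopologicalSpace H] [ChartedSpace F H] [Group H]

/-- The linear map of Lie algebras induced by a homomorphism, its differential at `1`. -/
def lieMap (E V : Type*) [NormedAddCommGroup E] [NormedSpace ℝ E]
    [NormedAddCommGroup V] [NormedSpace ℝ V]
    {G D : Type*} [TopologicalSpace G] [ChartedSpace E G] [Group G]
    [TopologicalSpace D] [ChartedSpace V D] [Group D] (f : G →* D) :
    LieAlg E G →L[ℝ] LieAlg V D :=
  mfderiv 𝓘(ℝ, E) 𝓘(ℝ, V) f 1

/-- The Lie group `D` is a group double `D(G, Λ_G)` of the Lie–Poisson group `(G, Λ_G)`, with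
`(H, Λ_H)` in the role of the dual Lie–Poisson group `(G*, Λ_{G*})`.

`G` and `H` are Lie subgroups of `D`, the Lie algebra of `D` carries an invariant scalar product
for which the Lie algebras of `G` and `H` are complementary and isotropic (so that each is the
dual of the other), and under this duality the bracket of the Lie algebra of `H` is the
linearization of `Λ_G` at the unit, while the bracket of the Lie algebra of `G` is the
linearization of `Λ_H` at the unit. -/
structure GroupDouble (ΛG : TensorField E G) (ΛH : TensorField F H)
    (V : Type*) [NormedAddCommGroup V] [NormedSpace ℝ V]
    (D : Type*) [TopologicalSpace D] [ChartedSpace V D] [Group D] where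
  /-- the inclusion of `G` -/
  i : G →* D
  /-- the inclusion of `H` -/
  j : H →* D
  smooth_i : ContMDiff 𝓘(ℝ, E) 𝓘(ℝ, V) ∞ i
  smooth_j : ContMDiff 𝓘(ℝ, F) 𝓘(ℝ, V) ∞ j
  injective_i : Function.Injective i
  injective_j : Function.Injective j
  immersive_i : Function.Injective (lieMap E V i)
  immersive_j : Function.Injective (lieMap F V j)
  /-- the scalar product -/
  form : LinearMap.BilinForm ℝ (LieAlg V D)
  form_symm : ∀ a b, form a b = form b a
  form_nondegenerate : form.Nondegenerate
  form_Ad : ∀ (d : D) (a b : LieAlg V D), form (Ad d a) (Ad d b) = form a b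
  isotropic_G : ∀ x x' : LieAlg E G, form (lieMap E V i x) (lieMap E V i x') = 0
  isotropic_H : ∀ y y' : LieAlg F H, form (lieMap F V j y) (lieMap F V j y') = 0
  isCompl : IsCompl (lieMap E V i).range (lieMap F V j).range
  /-- `(d_1 Λ_G)(x)(y, y') = ⟨x, [y, y']⟩`, where `α`, `α'` are `y`, `y'` seen as covectors -/
  dual_G : ∀ (x : LieAlg E G) (y y' : LieAlg F H) (α α' : Cotan E (1 : G)),
    (∀ z, α z = form (lieMap E V i z) (lieMap F V j y)) →
    (∀ z, α' z = form (lieMap E V i z) (lieMap F V j y')) →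
    linearization ΛG x α α' = form (lieMap E V i x) (lieMap F V j ⁅y, y'⁆)
  /-- `(d_1 Λ_H)(y)(x, x') = ⟨[x, x'], y⟩`, where `β`, `β'` are `x`, `x'` seen as covectors -/
  dual_H : ∀ (y : LieAlg F H) (x x' : LieAlg E G) (β β' : Cotan F (1 : H)),
    (∀ z, β z = form (lieMap E V i x) (lieMap F V j z)) →
    (∀ z, β' z = form (lieMap E V i x') (lieMap F V j z)) →
    linearization ΛH y β β' = form (lieMap E V i ⁅x, x'⁆) (lieMap F V j y)

namespace GroupDouble

variable {ΛG : TensorField E G} {ΛH : TensorField F H}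
  {D : Type*} [TopologicalSpace D] [ChartedSpace V D] [Group D]
  (P : GroupDouble ΛG ΛH V D)

/-- The projection of `Lie D = Lie G ⊕ Lie H` onto `Lie G`. -/
def projG : LieAlg V D →ₗ[ℝ] LieAlg V D := Submodule.projection _ _ P.isCompl

/-- The projection of `Lie D = Lie G ⊕ Lie H` onto `Lie H`. -/
def projH : LieAlg V D →ₗ[ℝ] LieAlg V D := Submodule.projection _ _ P.isCompl.symm

/-- The identification of `(Lie D)*` with `Lie D` through the scalar product. -/
def dualIso [FiniteDimensional ℝ V] : Cotan V (1 : D) →ₗ[ℝ] LieAlg V D :=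
  haveI : FiniteDimensional ℝ (LieAlg V D) := inferInstanceAs (FiniteDimensional ℝ V)
  (LinearMap.BilinForm.toDual P.form P.form_nondegenerate).symm.toLinearMap ∘ₗ
    ContinuousLinearMap.coeLM ℝ

/-- The canonical bivector `r = -∑ X_i ∧ Y_i = ∑ (Y_i ⊗ X_i - X_i ⊗ Y_i)` on `Lie D`, for dual
bases `X_i` of `Lie G` and `Y_i` of `Lie H`: the contraction with the covector of `a` is
`r ⟨a, ·⟩ = ∑ (⟨Y_i, a⟩ X_i - ⟨X_i, a⟩ Y_i)`, which is the `Lie G` part of `a` minus its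
`Lie H` part. -/
def rMatrix [FiniteDimensional ℝ V] : Cotan V (1 : D) →ₗ[ℝ] LieAlg V D :=
  (P.projG - P.projH) ∘ₗ P.dualIso

/-- The Poisson tensor `Λ_D^+ = (r^l + r^r) / 2` of the double, where `r^l` and `r^r` are the left-
and right-invariant bivector fields with the value `r` at the unit. -/
def lambdaPlus [FiniteDimensional ℝ V] (d : D) (θ : Cotan V d) : Tan V d :=
  (2⁻¹ : ℝ) • (leftTr d (P.rMatrix (θ.comp (leftTr d))) +
    rightTr d (P.rMatrix (θ.comp (rightTr d))))

/-- The group product `G × H → D`. -/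
def mulMap (p : G × H) : D := P.i p.1 * P.j p.2

/-- `D^+ = G · H ∩ H · G`. -/
def dPlus : Set D := {d | (∃ g u, d = P.i g * P.j u) ∧ (∃ u g, d = P.j u * P.i g)}

/-- `D` is complete: `D^+ = D`, and `D` is identified with `G × H` by the group product, that is,
the factorization `d = g u` is also unique (`G ∩ H = {1}`). -/
def IsComplete : Prop := P.dPlus = Set.univ ∧ Function.Injective P.mulMap

variable {P}

theorem IsComplete.bijective (hP : P.IsComplete) : Function.Bijective P.mulMap := by
  refine ⟨hP.2, fun d => ?_⟩
  have hd : d ∈ P.dPlus := by rw [hP.1]; trivial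
  obtain ⟨⟨g, u, h⟩, -⟩ := hd
  exact ⟨(g, u), h.symm⟩

/-- The coordinates `d ↦ (g, u)` on a complete double, where `d = g u`. -/
def IsComplete.coords (hP : P.IsComplete) : D ≃ G × H :=
  (Equiv.ofBijective P.mulMap hP.bijective).symm

/-- The projection `μ_G : D → G`, `g u ↦ g`. -/
def IsComplete.muG (hP : P.IsComplete) (d : D) : G := (hP.coords d).1

/-- The momentum map `μ_{G*} : D → H`, `g u ↦ u`. -/
def IsComplete.muH (hP : P.IsComplete) (d : D) : H := (hP.coords d).2

/-- The vector field `Γ_η = Λ_D^+(μ_{G*}^* η)` on `D`. -/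
def IsComplete.gammaField [FiniteDimensional ℝ V] (hP : P.IsComplete)
    (η : ∀ u : H, Cotan F u) (d : D) : Tan V d :=
  P.lambdaPlus d ((η (hP.muH d)).comp (mfderiv 𝓘(ℝ, V) 𝓘(ℝ, F) hP.muH d))

end GroupDouble

/-- The Legendre map `L_η : H → Lie G`, `L_η(u) = ∑ ⟨Y_k^r, η⟩(u) X_k`. -/
def legendre {κ : Type*} [Fintype κ] (X : Module.Basis κ ℝ (LieAlg E G))
    (Y : Module.Basis κ ℝ (LieAlg F H)) (η : ∀ u : H, Cotan F u) (u : H) : LieAlg E G :=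
  ∑ k, (η u (rightTr u (Y k))) • X k

end Double

end PoissonDouble

end

open PoissonDouble

/-!
The proof works on the Lie algebra `Lie D = Lie G ⊕ Lie H`. A tangent vector of `D` at `d = g u` is
the translate `g v u` of a unique `v` in `Lie D`, and the part of `v` in `Lie G`, resp. `Lie H`, is
its component in the coordinate `g`, resp. `u` (`GroupDouble.mulDeriv_apply`). Hence the group
product is a local diffeomorphism, and, being bijective, its inverse `d ↦ (g, u)` is smooth
(`GroupDouble.IsComplete.contMDiff_coords`).

Let `ξ = L_η(u)`, the element of `Lie G` that represents `η` at `u`. The 1-form `μ_{G*}^* η` at `g u`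
is `g v u ↦ ⟨ξ, v⟩`. Contracting with the right-invariant half of `Λ_D^+` gives half the translate of
`ξ`, since `Ad_g ξ` lies in `Lie G`. Contracting with the left-invariant half gives the same exactly
when `Ad_u⁻¹ ξ` lies in `Lie G` (`GroupDouble.lambdaPlus_eq`), and this is what the Casimir condition
says. Indeed `Λ_H`, trivialized by right translations, is the function
`(a, b) ↦ -⟨Ad_u pr_H Ad_u⁻¹ a, b⟩` on `Lie G × Lie G` (`GroupDouble.dualTensor_eq`), where `pr_H` is
the projection of `Lie D` onto `Lie H`. Both sides are cocycles on `H`, the left one because `Λ_H` is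
multiplicative; their derivatives at the unit agree because the linearization of `Λ_H` is the bracket
of `Lie G` and the scalar product is invariant; and on a connected group a cocycle with vanishing
derivative at the unit is zero (`eq_zero_of_cocycle`).

So `Γ_η` at `g u` is the translate of `ξ`, that is, `(ξ^l(g), 0)` in the coordinates. A curve is an
integral curve of `Γ_η` exactly when `u` is constant and `g` is an integral curve of the
left-invariant field of `L_η(u)`, and left-invariant fields are complete
(`exists_isOneParameterSubgroup`). As `η` need not be continuous, uniqueness of integral curves is
obtained from the coordinate equations, first for `u` and then for `g`.

Mathlib defines the Lie bracket through left-invariant vector fields. That it is the derivative of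
the adjoint action (`exists_hasMFDerivAt_adjoint`) is proved in the chart at the unit, where both are
expressed by the mixed second derivative of the multiplication. Tangent spaces are regarded as the
model space throughout, by the definition of `TangentSpace`.
-/

noncomputable section

namespace PoissonDouble

open Set Filter Topology

/-! ### The commutator of a group law in a chart -/

section Calculus
variable {E : Type*} [NormedAddCommGroup E] [NormedSpace ℝ E]

/-- If `f` is a multiplication on a neighbourhood of its unit `e` and `c (p, q) = p q p⁻¹` the
conjugation, in the form `f (c (p, q), p) = f (p, q)`, then the mixed second derivative of `c` at
`(e, e)` is the antisymmetrization of the mixed second derivative of `f`. -/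
theorem fderiv_conj_eq_commutator {f c : E × E → E} {e : E}
    (hf : ContDiffAt ℝ 2 f (e, e)) (hc : ContDiffAt ℝ 2 c (e, e))
    (hfe : ∀ᶠ p in 𝓝 e, f (p, e) = p) (hce : ∀ᶠ p in 𝓝 e, c (p, e) = e)
    (hec : ∀ᶠ q in 𝓝 e, c (e, q) = q)
    (hcf : ∀ᶠ z in 𝓝 (e, e), f (c z, z.1) = f z) (v w : E) :
    DifferentiableAt ℝ (fun p => fderiv ℝ c (p, e) (0, w)) e ∧
      fderiv ℝ (fun p => fderiv ℝ c (p, e) (0, w)) e v =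
        fderiv ℝ (fun p => fderiv ℝ f (p, e) (0, w)) e v -
          fderiv ℝ (fun p => fderiv ℝ f (p, e) (0, v)) e w := by
  have hpair : Tendsto (fun p : E => (p, e)) (𝓝 e) (𝓝 (e, e)) :=
    (Continuous.prodMk_left e).tendsto e
  have hpair' : Tendsto (fun p : E => (e, p)) (𝓝 e) (𝓝 (e, e)) :=
    (Continuous.prodMk_right e).tendsto e
  have hf2 : DifferentiableAt ℝ (fderiv ℝ f) (e, e) :=
    (hf.fderiv_right (m := 1) (by norm_num)).differentiableAt (by norm_num)
  have hc2 : DifferentiableAt ℝ (fderiv ℝ c) (e, e) :=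
    (hc.fderiv_right (m := 1) (by norm_num)).differentiableAt (by norm_num)
  have hfd : ∀ᶠ z in 𝓝 (e, e), DifferentiableAt ℝ f z :=
    (hf.eventually (by simp)).mono fun z hz => hz.differentiableAt (by norm_num)
  have hcd : ∀ᶠ z in 𝓝 (e, e), DifferentiableAt ℝ c z :=
    (hc.eventually (by simp)).mono fun z hz => hz.differentiableAt (by norm_num)
  have hl : HasFDerivAt (fun p : E => (p, e)) (ContinuousLinearMap.inl ℝ E E) e :=
    hasFDerivAt_prodMk_left e e
  have hr : HasFDerivAt (fun p : E => (e, p)) (ContinuousLinearMap.inr ℝ E E) e :=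
    hasFDerivAt_prodMk_right e e
  have hl2 (u : E × E) : HasFDerivAt (fun p => fderiv ℝ f (p, e) u)
      (((fderiv ℝ (fderiv ℝ f) (e, e)).comp (.inl ℝ E E)).flip u) e :=
    ((HasFDerivAt.comp e (f := fun p : E => (p, e)) hf2.hasFDerivAt hl).clm_apply
      (hasFDerivAt_const u e)).congr_fderiv (by ext; simp)
  have hr2 : HasFDerivAt (fun p => fderiv ℝ f (e, p))
      ((fderiv ℝ (fderiv ℝ f) (e, e)).comp (.inr ℝ E E)) e :=
    HasFDerivAt.comp e (f := fun p : E => (e, p)) hf2.hasFDerivAt hr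
  have hA : DifferentiableAt ℝ (fun p => fderiv ℝ c (p, e) (0, w)) e :=
    (DifferentiableAt.comp e (f := fun p : E => (p, e)) hc2 hl.differentiableAt).clm_apply
      (differentiableAt_const _)
  refine ⟨hA, ?_⟩
  have hAe : fderiv ℝ c (e, e) (0, w) = w := by
    have h1 : HasFDerivAt (fun q => c (e, q)) ((fderiv ℝ c (e, e)).comp (.inr ℝ E E)) e :=
      HasFDerivAt.comp e (f := fun p : E => (e, p)) hcd.self_of_nhds.hasFDerivAt hr
    have h2 := (h1.congr_of_eventuallyEq (f₁ := id) (hec.mono fun q hq => hq.symm)).unique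
      (hasFDerivAt_id e)
    simpa using congrArg (fun L : E →L[ℝ] E => L w) h2
  have hfl (z : E) : fderiv ℝ f (e, e) (z, 0) = z := by
    have h1 : HasFDerivAt (fun q => f (q, e)) ((fderiv ℝ f (e, e)).comp (.inl ℝ E E)) e :=
      HasFDerivAt.comp e (f := fun p : E => (p, e)) hfd.self_of_nhds.hasFDerivAt hl
    have h2 := (h1.congr_of_eventuallyEq (f₁ := id) (hfe.mono fun q hq => hq.symm)).unique
      (hasFDerivAt_id e)
    simpa using congrArg (fun L : E →L[ℝ] E => L z) h2
  -- the identity `f (c z, z.1) = f z`, differentiated in the second variable at `(p, e)`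
  have hkey : ∀ᶠ p in 𝓝 e,
      fderiv ℝ f (e, p) (fderiv ℝ c (p, e) (0, w), 0) = fderiv ℝ f (p, e) (0, w) := by
    filter_upwards [hpair.eventually hcf.eventually_nhds, hpair.eventually hfd,
      hpair'.eventually hfd, hpair.eventually hcd, hce] with p h1 h2 h3 h4 h5
    have h6 : HasFDerivAt (fun z : E × E => (c z, z.1))
        ((fderiv ℝ c (p, e)).prod (.fst ℝ E E)) (p, e) :=
      h4.hasFDerivAt.prodMk hasFDerivAt_fst
    have h3' : HasFDerivAt f (fderiv ℝ f (e, p)) (c (p, e), p) := by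
      rw [h5]; exact h3.hasFDerivAt
    have h7 := (HasFDerivAt.comp (p, e) (f := fun z : E × E => (c z, z.1)) h3' h6)
    have h8 := (h7.congr_of_eventuallyEq (f₁ := f) (h1.mono fun z hz => hz.symm)).unique
      h2.hasFDerivAt
    simpa using congrArg (fun L : E × E →L[ℝ] E => L (0, w)) h8
  have hL : HasFDerivAt (fun p => fderiv ℝ f (e, p) (fderiv ℝ c (p, e) (0, w), 0)) _ e :=
    hr2.clm_apply (hA.hasFDerivAt.prodMk (hasFDerivAt_const (0 : E) e))
  have h := congrArg (fun L : E →L[ℝ] E => L v)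
    ((hL.congr_of_eventuallyEq (hkey.mono fun p hp => hp.symm)).unique (hl2 (0, w)))
  have hsymm : IsSymmSndFDerivAt ℝ f (e, e) := hf.isSymmSndFDerivAt (by simp)
  rw [(hl2 (0, w)).fderiv, (hl2 (0, v)).fderiv]
  simp only [_root_.add_apply, ContinuousLinearMap.comp_apply,
    ContinuousLinearMap.flip_apply, ContinuousLinearMap.prod_apply,
    _root_.zero_apply, ContinuousLinearMap.inl_apply,
    ContinuousLinearMap.inr_apply, hAe, hfl] at h ⊢
  rw [← h, hsymm.eq (0, v) (w, 0)]
  abel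

end Calculus

/-! ### The inverse function theorem and constant functions on manifolds -/

section Manifold
variable {E E' : Type*} [NormedAddCommGroup E] [NormedSpace ℝ E]
  [NormedAddCommGroup E'] [NormedSpace ℝ E']
  {X X' : Type*} [TopologicalSpace X] [TopologicalSpace X']
  {I : ModelWithCorners ℝ E X} {J : ModelWithCorners ℝ E' X'}
  {M N : Type*} [TopologicalSpace M] [ChartedSpace X M] [TopologicalSpace N] [ChartedSpace X' N]

/-- The inverse function theorem on manifolds without boundary: a map with invertible differential
has a smooth local section. -/
theorem exists_contMDiffAt_section [CompleteSpace E]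
    [I.Boundaryless] [J.Boundaryless] [IsManifold I ∞ M] [IsManifold J ∞ N]
    {f : M → N} {x : M} (hf : ContMDiffAt I J ∞ f x) (L : E ≃L[ℝ] E')
    (hL : HasMFDerivAt I J f x (L : E →L[ℝ] E')) :
    ∃ s : N → M, ContMDiffAt J I ∞ s (f x) ∧ ∀ᶠ y in 𝓝 (f x), f (s y) = y := by
  set φ := extChartAt I x
  set ψ := extChartAt J (f x)
  have hF : ContDiffAt ℝ ∞ (ψ ∘ f ∘ φ.symm) (φ x) := by
    have := (contMDiffAt_iff.1 hf).2
    rwa [I.range_eq_univ, contDiffWithinAt_univ] at this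
  have hF' : HasFDerivAt (ψ ∘ f ∘ φ.symm) (L : E →L[ℝ] E') (φ x) := by
    have : HasFDerivWithinAt (ψ ∘ f ∘ φ.symm) (L : E →L[ℝ] E') (range I) (φ x) := hL.2
    rwa [I.range_eq_univ, hasFDerivWithinAt_univ] at this
  have hFx : (ψ ∘ f ∘ φ.symm) (φ x) = ψ (f x) :=
    congrArg (fun z => ψ (f z)) (extChartAt_to_inv x)
  set σ := hF.localInverse hF' (by simp)
  have hσ : ContDiffAt ℝ ∞ σ (ψ (f x)) := hFx ▸ hF.to_localInverse hF' (by simp)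
  have hσx : σ (ψ (f x)) = φ x := hFx ▸ hF.localInverse_apply_image hF' (by simp)
  have hσr : ∀ᶠ z in 𝓝 (ψ (f x)), (ψ ∘ f ∘ φ.symm) (σ z) = z :=
    hFx ▸ (hF.hasStrictFDerivAt' hF' (by simp)).eventually_right_inverse
  have hψ : ContMDiffAt J 𝓘(ℝ, E') ∞ ψ (f x) := contMDiffAt_extChartAt
  have hφ : ContMDiffAt 𝓘(ℝ, E) I ∞ φ.symm (φ x) :=
    (contMDiffOn_extChartAt_symm x).contMDiffAt (extChartAt_target_mem_nhds x)
  have hs : ContMDiffAt J I ∞ (φ.symm ∘ σ ∘ ψ) (f x) :=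
    ContMDiffAt.comp_of_eq (y := φ x) hφ (hσ.contMDiffAt.comp _ hψ) hσx
  have hsx : (φ.symm ∘ σ ∘ ψ) (f x) = x :=
    (congrArg φ.symm hσx).trans (extChartAt_to_inv x)
  refine ⟨φ.symm ∘ σ ∘ ψ, hs, ?_⟩
  have hfs : ContinuousAt (fun y => f ((φ.symm ∘ σ ∘ ψ) y)) (f x) :=
    ContinuousAt.comp_of_eq hf.continuousAt hs.continuousAt hsx
  have hfsx : f ((φ.symm ∘ σ ∘ ψ) (f x)) = f x := congrArg f hsx
  have hmem : ∀ᶠ y in 𝓝 (f x), f ((φ.symm ∘ σ ∘ ψ) y) ∈ ψ.source :=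
    hfs.eventually_mem (by rw [hfsx]; exact extChartAt_source_mem_nhds _)
  filter_upwards [hψ.continuousAt.eventually hσr, hmem,
    extChartAt_source_mem_nhds (I := J) (f x)] with y h1 h2 h3
  exact ψ.injOn h2 h3 h1

theorem eq_of_hasMFDerivAt_zero [ConnectedSpace M] [I.Boundaryless] [IsManifold I 1 M]
    {f : M → ℝ} (hf : ∀ x, HasMFDerivAt I 𝓘(ℝ, ℝ) f x (0 : E →L[ℝ] ℝ)) (x y : M) : f x = f y := by
  suffices h : IsLocallyConstant f from h.apply_eq_of_preconnectedSpace x y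
  rw [IsLocallyConstant.iff_eventually_eq]
  intro x
  set φ := extChartAt I x
  obtain ⟨r, hr, hball⟩ := Metric.mem_nhds_iff.1 (extChartAt_target_mem_nhds (I := I) x)
  have hd : ∀ p ∈ Metric.ball (φ x) r, HasFDerivAt (f ∘ φ.symm) (0 : E →L[ℝ] ℝ) p := by
    intro p hp
    have h1 : MDifferentiableAt 𝓘(ℝ, E) I φ.symm p :=
      ((contMDiffOn_extChartAt_symm (n := 1) x).contMDiffAt
        ((isOpen_extChartAt_target x).mem_nhds (hball hp))).mdifferentiableAt (by simp)
    have h2 := (hf (φ.symm p)).comp p h1.hasMFDerivAt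
    have h3 := h2.hasFDerivAt
    refine h3.congr_fderiv ?_
    exact ContinuousLinearMap.zero_comp _
  have hc : ∀ p ∈ Metric.ball (φ x) r, (f ∘ φ.symm) p = (f ∘ φ.symm) (φ x) := by
    intro p hp
    exact (convex_ball (φ x) r).is_const_of_fderivWithin_eq_zero (𝕜 := ℝ)
      (fun q hq => (hd q hq).differentiableAt.differentiableWithinAt)
      (fun q hq => by
        rw [fderivWithin_of_isOpen Metric.isOpen_ball hq, (hd q hq).fderiv]) hp
      (Metric.mem_ball_self hr)
  have hcont : ContinuousAt φ x := continuousAt_extChartAt x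
  filter_upwards [hcont (Metric.ball_mem_nhds _ hr), extChartAt_source_mem_nhds (I := I) x]
    with y hy hys
  have := hc _ hy
  have h1 : φ.symm (φ y) = y := φ.left_inv hys
  have h2 : φ.symm (φ x) = x := extChartAt_to_inv x
  rwa [Function.comp_apply, Function.comp_apply, h1, h2] at this

end Manifold

/-! ### The bracket as the derivative of the adjoint action -/

section ChartAtOne
variable {E : Type*} [NormedAddCommGroup E] [NormedSpace ℝ E]
  {G : Type*} [TopologicalSpace G] [ChartedSpace E G] [Group G]

/-- The Lie bracket of `Lie G`, with the Lie algebra regarded as the model space `E`. -/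
def lieBracket (E G : Type*) [NormedAddCommGroup E] [NormedSpace ℝ E] [TopologicalSpace G]
    [ChartedSpace E G] [Group G] (v w : LieAlg E G) : E :=
  (⁅v, w⁆ : LieAlg E G)

/-- The adjoint action, with the Lie algebra regarded as the model space `E`. -/
def adjoint (g : G) : E →L[ℝ] E := Ad g

/-- The preferred chart at the unit, in which the tangent space at the unit is the model space. -/
def unitChart (E G : Type*) [NormedAddCommGroup E] [NormedSpace ℝ E] [TopologicalSpace G]
    [ChartedSpace E G] [Group G] : PartialEquiv G E := extChartAt 𝓘(ℝ, E) (1 : G)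

/-- The multiplication of `G` read in the chart at the unit; meaningful near the image of
`(1, 1)`. -/
def chartMul (E G : Type*) [NormedAddCommGroup E] [NormedSpace ℝ E] [TopologicalSpace G]
    [ChartedSpace E G] [Group G] (z : E × E) : E :=
  unitChart E G ((unitChart E G).symm z.1 * (unitChart E G).symm z.2)

/-- The conjugation `(g, h) ↦ g h g⁻¹` read in the chart at the unit; meaningful near the image of
`(1, 1)`. -/
def chartConj (E G : Type*) [NormedAddCommGroup E] [NormedSpace ℝ E] [TopologicalSpace G]
    [ChartedSpace E G] [Group G] (z : E × E) : E :=
  unitChart E G ((unitChart E G).symm z.1 * (unitChart E G).symm z.2 *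
    ((unitChart E G).symm z.1)⁻¹)

local notation "φ" => unitChart E G
local notation "e" => unitChart E G 1

theorem unitChart_symm_one : (φ).symm e = 1 := extChartAt_to_inv (1 : G)

theorem eventually_mem_target : ∀ᶠ p in 𝓝 e, p ∈ (φ).target :=
  extChartAt_target_mem_nhds (1 : G)

theorem chartMul_left_unit : ∀ᶠ p in 𝓝 e, chartMul E G (e, p) = p :=
  eventually_mem_target.mono fun p hp => by
    simpa [chartMul, unitChart_symm_one] using (φ).right_inv hp

theorem chartMul_right_unit : ∀ᶠ p in 𝓝 e, chartMul E G (p, e) = p :=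
  eventually_mem_target.mono fun p hp => by
    simpa [chartMul, unitChart_symm_one] using (φ).right_inv hp

theorem chartConj_unit (p : E) : chartConj E G (p, e) = e := by
  simp [chartConj, unitChart_symm_one]

theorem chartConj_unit_left : ∀ᶠ p in 𝓝 e, chartConj E G (e, p) = p :=
  eventually_mem_target.mono fun p hp => by
    simpa [chartConj, unitChart_symm_one] using (φ).right_inv hp

theorem contMDiffAt_unitChart [IsManifold 𝓘(ℝ, E) ∞ G] :
    ContMDiffAt 𝓘(ℝ, E) 𝓘(ℝ, E) ∞ φ (1 : G) := contMDiffAt_extChartAt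

variable [LieGroup 𝓘(ℝ, E) ∞ G]

theorem contMDiffAt_unitChart_symm : ContMDiffAt 𝓘(ℝ, E) 𝓘(ℝ, E) ∞ (φ).symm e :=
  (contMDiffOn_extChartAt_symm (1 : G)).contMDiffAt (extChartAt_target_mem_nhds (1 : G))

theorem hasMFDerivAt_unitChart :
    HasMFDerivAt 𝓘(ℝ, E) 𝓘(ℝ, E) φ (1 : G) (ContinuousLinearMap.id ℝ E) := by
  have h := ((contMDiffAt_unitChart (E := E) (G := G)).mdifferentiableAt (by simp)).hasMFDerivAt
  have h2 : mfderiv 𝓘(ℝ, E) 𝓘(ℝ, E) φ (1 : G) = ContinuousLinearMap.id ℝ E :=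
    mfderiv_extChartAt_self (I := 𝓘(ℝ, E)) (x := (1 : G))
  rwa [h2] at h

theorem hasMFDerivAt_unitChart_symm :
    HasMFDerivAt 𝓘(ℝ, E) 𝓘(ℝ, E) (φ).symm e (ContinuousLinearMap.id ℝ E) := by
  have h := ((contMDiffAt_unitChart_symm (E := E) (G := G)).mdifferentiableAt
    (by simp)).hasMFDerivAt
  have h2 : mfderivWithin 𝓘(ℝ, E) 𝓘(ℝ, E) (φ).symm (range 𝓘(ℝ, E)) e
      = ContinuousLinearMap.id ℝ E :=
    mfderivWithin_range_extChartAt_symm (I := 𝓘(ℝ, E)) (x := (1 : G))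
  rw [ModelWithCorners.range_eq_univ, mfderivWithin_univ] at h2
  rwa [h2] at h

theorem contMDiffAt_unitChart_symm_fst :
    ContMDiffAt 𝓘(ℝ, E × E) 𝓘(ℝ, E) ∞ (fun z : E × E => (φ).symm z.1) (e, e) :=
  ContMDiffAt.comp (e, e) (f := Prod.fst) contMDiffAt_unitChart_symm
    contDiff_fst.contMDiff.contMDiffAt

theorem contMDiffAt_unitChart_symm_snd :
    ContMDiffAt 𝓘(ℝ, E × E) 𝓘(ℝ, E) ∞ (fun z : E × E => (φ).symm z.2) (e, e) :=
  ContMDiffAt.comp (e, e) (f := Prod.snd) contMDiffAt_unitChart_symm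
    contDiff_snd.contMDiff.contMDiffAt

theorem contMDiffAt_unitChart_symm_conj : ContMDiffAt 𝓘(ℝ, E × E) 𝓘(ℝ, E) ∞
    (fun z : E × E => (φ).symm z.1 * (φ).symm z.2 * ((φ).symm z.1)⁻¹) (e, e) :=
  (contMDiffAt_unitChart_symm_fst.mul contMDiffAt_unitChart_symm_snd).mul
    contMDiffAt_unitChart_symm_fst.inv

theorem contDiffAt_chartMul : ContDiffAt ℝ ∞ (chartMul E G) (e, e) := by
  refine ContMDiffAt.contDiffAt (ContMDiffAt.comp_of_eq (y := (1 : G)) contMDiffAt_unitChart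
    (contMDiffAt_unitChart_symm_fst.mul contMDiffAt_unitChart_symm_snd) ?_)
  simp [unitChart_symm_one]

theorem contDiffAt_chartConj : ContDiffAt ℝ ∞ (chartConj E G) (e, e) := by
  refine ContMDiffAt.contDiffAt (ContMDiffAt.comp_of_eq (y := (1 : G)) contMDiffAt_unitChart
    contMDiffAt_unitChart_symm_conj ?_)
  simp [unitChart_symm_one]

theorem chartMul_chartConj :
    ∀ᶠ z in 𝓝 (e, e), chartMul E G (chartConj E G z, z.1) = chartMul E G z := by
  have h3 := (contMDiffAt_unitChart_symm_conj (E := E) (G := G)).continuousAt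
  have h4 : (φ).source ∈ 𝓝 (1 : G) := extChartAt_source_mem_nhds (1 : G)
  filter_upwards [h3.eventually_mem (s := (φ).source) (by simpa [unitChart_symm_one] using h4)]
    with z hz
  have : (φ).symm (φ ((φ).symm z.1 * (φ).symm z.2 * ((φ).symm z.1)⁻¹)) =
    (φ).symm z.1 * (φ).symm z.2 * ((φ).symm z.1)⁻¹ := (φ).left_inv hz
  simp only [chartMul, chartConj, this, inv_mul_cancel_right]

theorem hasFDerivAt_chart_of_hasMFDerivAt_one {f : G → E} {L : E →L[ℝ] E}
    (h : HasMFDerivAt 𝓘(ℝ, E) 𝓘(ℝ, E) f 1 L) : HasFDerivAt (f ∘ (φ).symm) L e := by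
  have h' : HasMFDerivAt 𝓘(ℝ, E) 𝓘(ℝ, E) f ((φ).symm e) L := by
    rw [unitChart_symm_one]; exact h
  exact (h'.comp e hasMFDerivAt_unitChart_symm).hasFDerivAt

/-- In the chart at the unit, the left-invariant vector field of `v` is the partial derivative of
the multiplication in its second argument. -/
theorem fderiv_chartMul_eq (v : E) : ∀ᶠ p in 𝓝 e,
    (mfderivWithin 𝓘(ℝ, E) 𝓘(ℝ, E) (φ).symm (range 𝓘(ℝ, E)) p).inverse
      (mulInvariantVectorField (I := 𝓘(ℝ, E)) (G := G) v ((φ).symm p)) =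
    fderiv ℝ (chartMul E G) (p, e) (0, v) := by
  have hpair : Tendsto (fun p : E => (p, e)) (𝓝 e) (𝓝 (e, e)) :=
    (Continuous.prodMk_left _).tendsto _
  have hfd : ∀ᶠ z in 𝓝 (e, e), DifferentiableAt ℝ (chartMul E G) z :=
    ((contDiffAt_chartMul.of_le (m := 1) (by simp)).eventually (by simp)).mono
      fun z hz => hz.differentiableAt (by norm_num)
  filter_upwards [hpair.eventually hfd, eventually_mem_target] with p h1 hp
  have : IsManifold 𝓘(ℝ, E) 1 G := IsManifold.of_le (n := ∞) (by simp)
  have hinv := ContinuousLinearMap.inverse_eq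
    (mfderivWithin_extChartAt_symm_comp_mfderiv_extChartAt (I := 𝓘(ℝ, E)) (x := (1 : G)) hp)
    (mfderiv_extChartAt_comp_mfderivWithin_extChartAt_symm (I := 𝓘(ℝ, E)) (x := (1 : G)) hp)
  refine (congrArg (fun L : E →L[ℝ] E =>
    L (mulInvariantVectorField (I := 𝓘(ℝ, E)) (G := G) v ((φ).symm p))) hinv).trans ?_
  have hmem : (φ).symm p ∈ (chartAt E (1 : G)).source := by
    have := (φ).map_target hp
    rwa [unitChart, extChartAt_source] at this
  have hφ := (mdifferentiableAt_extChartAt (I := 𝓘(ℝ, E)) hmem).hasMFDerivAt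
  have hmul : HasMFDerivAt 𝓘(ℝ, E) 𝓘(ℝ, E) (fun x : G => (φ).symm p * x) 1
      (mfderiv 𝓘(ℝ, E) 𝓘(ℝ, E) (fun x : G => (φ).symm p * x) 1) :=
    ((contMDiff_mul_left (I := 𝓘(ℝ, E)) (n := ∞)).mdifferentiable (by simp) _).hasMFDerivAt
  have hφ' : HasMFDerivAt 𝓘(ℝ, E) 𝓘(ℝ, E) φ ((φ).symm p * 1)
      (mfderiv 𝓘(ℝ, E) 𝓘(ℝ, E) φ ((φ).symm p) : E →L[ℝ] E) := by
    rw [mul_one]; exact hφ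
  have hcomp := hasFDerivAt_chart_of_hasMFDerivAt_one (hφ'.comp 1 hmul)
  have hr : HasFDerivAt (fun q : E => (p, q)) (ContinuousLinearMap.inr ℝ E E) e :=
    hasFDerivAt_prodMk_right p e
  have h3 := HasFDerivAt.comp e (f := fun q : E => (p, q)) h1.hasFDerivAt hr
  have h4 := congrArg (fun L : E →L[ℝ] E => L v) (HasFDerivAt.unique hcomp h3)
  exact h4

theorem fderiv_chartMul_unit (v : E) : fderiv ℝ (chartMul E G) (e, e) (0, v) = v := by
  have hr : HasFDerivAt (fun q : E => (e, q)) (ContinuousLinearMap.inr ℝ E E) e :=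
    hasFDerivAt_prodMk_right e e
  have h1 : DifferentiableAt ℝ (chartMul E G) (e, e) :=
    contDiffAt_chartMul.differentiableAt (by simp)
  have h2 := HasFDerivAt.comp e (f := fun q : E => (e, q)) h1.hasFDerivAt hr
  have h3 := (h2.congr_of_eventuallyEq (f₁ := id)
    (chartMul_left_unit.mono fun q hq => hq.symm)).unique (hasFDerivAt_id e)
  simpa using congrArg (fun L : E →L[ℝ] E => L v) h3

theorem lieBracket_eq_chart (v w : E) : lieBracket E G v w =
    fderiv ℝ (fun p => fderiv ℝ (chartMul E G) (p, e) (0, w)) e v -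
      fderiv ℝ (fun p => fderiv ℝ (chartMul E G) (p, e) (0, v)) e w := by
  have : IsManifold 𝓘(ℝ, E) 1 G := IsManifold.of_le (n := ∞) (by simp)
  let V (u : E) (p : E) : E :=
    (mfderivWithin 𝓘(ℝ, E) 𝓘(ℝ, E) (φ).symm (range 𝓘(ℝ, E)) p).inverse
      (mulInvariantVectorField (I := 𝓘(ℝ, E)) (G := G) u ((φ).symm p))
  let T : E →L[ℝ] E := mfderiv 𝓘(ℝ, E) 𝓘(ℝ, E) φ (1 : G)
  let B : E := VectorField.lieBracketWithin ℝ (V v) (V w)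
    ((φ).symm ⁻¹' univ ∩ range 𝓘(ℝ, E)) e
  have h2 : T = ContinuousLinearMap.id ℝ E := hasMFDerivAt_unitChart.mfderiv
  have h3 : T.inverse B = B := by rw [h2, ContinuousLinearMap.inverse_id]; rfl
  have hV (u : E) : V u =ᶠ[𝓝 e] fun p => fderiv ℝ (chartMul E G) (p, e) (0, u) :=
    fderiv_chartMul_eq u
  have h4 : B = fderiv ℝ (fun p => fderiv ℝ (chartMul E G) (p, e) (0, w)) e v -
      fderiv ℝ (fun p => fderiv ℝ (chartMul E G) (p, e) (0, v)) e w := by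
    simp only [B]
    rw [ModelWithCorners.range_eq_univ, preimage_univ,
      univ_inter, VectorField.lieBracketWithin_univ, (hV v).lieBracket_vectorField_eq (hV w),
      VectorField.lieBracket_eq]
    simp only [fderiv_chartMul_unit]
  exact h3.trans h4

theorem adjoint_eq_chart (w : E) : ∀ᶠ p in 𝓝 e,
    adjoint ((φ).symm p) w = fderiv ℝ (chartConj E G) (p, e) (0, w) := by
  have hpair : Tendsto (fun p : E => (p, e)) (𝓝 e) (𝓝 (e, e)) :=
    (Continuous.prodMk_left _).tendsto _
  have hfd : ∀ᶠ z in 𝓝 (e, e), DifferentiableAt ℝ (chartConj E G) z :=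
    ((contDiffAt_chartConj.of_le (m := 1) (by simp)).eventually (by simp)).mono
      fun z hz => hz.differentiableAt (by norm_num)
  filter_upwards [hpair.eventually hfd] with p h1
  have hconj : HasMFDerivAt 𝓘(ℝ, E) 𝓘(ℝ, E) (fun x : G => (φ).symm p * x * ((φ).symm p)⁻¹) 1
      (Ad ((φ).symm p) : E →L[ℝ] E) :=
    (((contMDiff_mul_left (I := 𝓘(ℝ, E)) (n := ∞)).mul
      contMDiff_const).mdifferentiable (by simp) _).hasMFDerivAt
  have hφ : HasMFDerivAt 𝓘(ℝ, E) 𝓘(ℝ, E) φ ((φ).symm p * 1 * ((φ).symm p)⁻¹)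
      (ContinuousLinearMap.id ℝ E) := by
    have := hasMFDerivAt_unitChart (E := E) (G := G)
    rwa [mul_one, mul_inv_cancel]
  have hcomp := hasFDerivAt_chart_of_hasMFDerivAt_one (hφ.comp 1 hconj)
  have hr : HasFDerivAt (fun q : E => (p, q)) (ContinuousLinearMap.inr ℝ E E) e :=
    hasFDerivAt_prodMk_right p e
  have h3 := HasFDerivAt.comp e (f := fun q : E => (p, q)) h1.hasFDerivAt hr
  exact congrArg (fun L : E →L[ℝ] E => L w) (HasFDerivAt.unique hcomp h3)

/-- The adjoint action is differentiable at the unit, with the Lie bracket as its derivative. The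
existential form provides the differentiability together with the value. -/
theorem exists_hasMFDerivAt_adjoint (w : E) : ∃ L : E →L[ℝ] E,
    HasMFDerivAt 𝓘(ℝ, E) 𝓘(ℝ, E) (fun g : G => adjoint g w) 1 L ∧
      ∀ v : E, L v = lieBracket E G v w := by
  have h (v : E) := fderiv_conj_eq_commutator 
    ((contDiffAt_chartMul (E := E) (G := G)).of_le (m := 2) (WithTop.coe_le_coe.2 le_top))
    (contDiffAt_chartConj.of_le (m := 2) (WithTop.coe_le_coe.2 le_top)) (chartMul_right_unit (E := E) (G := G))
    (.of_forall chartConj_unit) chartConj_unit_left chartMul_chartConj v w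
  refine ⟨fderiv ℝ (fun p => fderiv ℝ (chartConj E G) (p, e) (0, w)) e, ?_, fun v =>
    (h v).2.trans (lieBracket_eq_chart v w).symm⟩
  have h1 := ((h 0).1.hasFDerivAt).congr_of_eventuallyEq (adjoint_eq_chart (G := G) w)
  have h2 : HasMFDerivAt 𝓘(ℝ, E) 𝓘(ℝ, E) ((fun p => adjoint ((φ).symm p) w) ∘ φ) (1 : G) _ :=
    HasMFDerivAt.comp (1 : G) h1.hasMFDerivAt hasMFDerivAt_unitChart
  refine h2.congr_of_eventuallyEq ?_
  filter_upwards [extChartAt_source_mem_nhds (I := 𝓘(ℝ, E)) (1 : G)] with g hg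
  have : (φ).symm (φ g) = g := (φ).left_inv hg
  simp only [Function.comp_apply, this]

end ChartAtOne

/-! ### Differentials on the model spaces -/

section Derivative
variable {E E' E'' : Type*} [NormedAddCommGroup E] [NormedSpace ℝ E]
  [NormedAddCommGroup E'] [NormedSpace ℝ E'] [NormedAddCommGroup E''] [NormedSpace ℝ E'']
  {M M' M'' : Type*} [TopologicalSpace M] [ChartedSpace E M] [TopologicalSpace M']
  [ChartedSpace E' M'] [TopologicalSpace M''] [ChartedSpace E'' M'']

/-- The differential of `f` at `x`, with the tangent spaces regarded as the model spaces. -/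
def tderiv (E E' : Type*) [NormedAddCommGroup E] [NormedSpace ℝ E] [NormedAddCommGroup E']
    [NormedSpace ℝ E'] {M M' : Type*} [TopologicalSpace M] [ChartedSpace E M]
    [TopologicalSpace M'] [ChartedSpace E' M'] (f : M → M') (x : M) : E →L[ℝ] E' :=
  mfderiv 𝓘(ℝ, E) 𝓘(ℝ, E') f x

theorem hasMFDerivAt_tderiv {f : M → M'} {x : M}
    (hf : MDifferentiableAt 𝓘(ℝ, E) 𝓘(ℝ, E') f x) :
    HasMFDerivAt 𝓘(ℝ, E) 𝓘(ℝ, E') f x (tderiv E E' f x) := hf.hasMFDerivAt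

theorem tderiv_comp_apply {f : M → M'} {g : M' → M''} {k : M → M''} {x : M} {y : M'}
    (hg : MDifferentiableAt 𝓘(ℝ, E') 𝓘(ℝ, E'') g y)
    (hf : MDifferentiableAt 𝓘(ℝ, E) 𝓘(ℝ, E') f x) (hy : f x = y) (h : ∀ z, g (f z) = k z)
    (v : E) : tderiv E' E'' g y (tderiv E E' f x v) = tderiv E E'' k x v := by
  subst hy
  obtain rfl : g ∘ f = k := funext h
  exact (mfderiv_comp_apply x hg hf v).symm

theorem tderiv_id (x : M) (v : E) : tderiv E E (fun z : M => z) x v = v :=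
  congrArg (fun L : E →L[ℝ] E => L v) (mfderiv_id (I := 𝓘(ℝ, E)) (x := x))

theorem hasMFDerivAt_bilinear {V : Type*} [NormedAddCommGroup V] [NormedSpace ℝ V]
    {c : V →L[ℝ] V →L[ℝ] ℝ} {f g : M → V} {x : M} {f' g' : E →L[ℝ] V}
    (hf : HasMFDerivAt 𝓘(ℝ, E) 𝓘(ℝ, V) f x f') (hg : HasMFDerivAt 𝓘(ℝ, E) 𝓘(ℝ, V) g x g') :
    HasMFDerivAt 𝓘(ℝ, E) 𝓘(ℝ, ℝ) (fun z => c (f z) (g z)) x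
      ((c (f x)).comp g' + (c.flip (g x)).comp f') := by
  have hq : HasFDerivAt (fun z : V × V => c z.1 z.2) (c.deriv₂ (f x, g x)) (f x, g x) :=
    c.isBoundedBilinearMap.hasFDerivAt (f x, g x)
  have hfg : HasMFDerivAt 𝓘(ℝ, E) 𝓘(ℝ, V × V) (fun z => (f z, g z)) x (f'.prod g') :=
    ⟨hf.1.prodMk hg.1, HasFDerivWithinAt.prodMk hf.2 hg.2⟩
  refine (HasMFDerivAt.comp x (f := fun z => (f z, g z)) hq.hasMFDerivAt hfg).congr_mfderiv ?_
  ext v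
  rfl

end Derivative

/-! ### Translations, the adjoint action and homomorphisms -/

section LieGroupDerivative
variable {E E' : Type*} [NormedAddCommGroup E] [NormedSpace ℝ E]
  [NormedAddCommGroup E'] [NormedSpace ℝ E']
  {G : Type*} [TopologicalSpace G] [ChartedSpace E G] [Group G]
  {G' : Type*} [TopologicalSpace G'] [ChartedSpace E' G'] [Group G']

/-- The differential at `x` of the left translation by `g`. -/
def dLeft (g x : G) : E →L[ℝ] E := tderiv E E (fun z : G => g * z) x

/-- The differential at `x` of the right translation by `g`. -/
def dRight (g x : G) : E →L[ℝ] E := tderiv E E (fun z : G => z * g) x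

theorem dLeft_one (x : G) (v : E) : dLeft 1 x v = v := by
  simp only [dLeft, one_mul, tderiv_id]

theorem dRight_one (x : G) (v : E) : dRight 1 x v = v := by
  simp only [dRight, mul_one, tderiv_id]

theorem lieBracket_swap (v w : E) : lieBracket E G v w = -lieBracket E G w v :=
  VectorField.mlieBracket_swap_apply

variable [LieGroup 𝓘(ℝ, E) ∞ G] [LieGroup 𝓘(ℝ, E') ∞ G']

theorem mdifferentiableAt_mul_left (g x : G) :
    MDifferentiableAt 𝓘(ℝ, E) 𝓘(ℝ, E) (fun z : G => g * z) x :=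
  (contMDiff_mul_left (I := 𝓘(ℝ, E)) (n := ∞)).mdifferentiable (by simp) x

theorem mdifferentiableAt_mul_right (g x : G) :
    MDifferentiableAt 𝓘(ℝ, E) 𝓘(ℝ, E) (fun z : G => z * g) x :=
  (contMDiff_mul_right (I := 𝓘(ℝ, E)) (n := ∞)).mdifferentiable (by simp) x

theorem mdifferentiableAt_conj (g x : G) :
    MDifferentiableAt 𝓘(ℝ, E) 𝓘(ℝ, E) (fun z : G => g * z * g⁻¹) x :=
  (mdifferentiableAt_mul_right g⁻¹ (g * x)).comp x (mdifferentiableAt_mul_left g x)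

theorem dLeft_dLeft (g h x : G) (v : E) : dLeft g (h * x) (dLeft h x v) = dLeft (g * h) x v :=
  tderiv_comp_apply (mdifferentiableAt_mul_left _ _) (mdifferentiableAt_mul_left _ _) rfl
    (fun z => (mul_assoc g h z).symm) v

theorem dRight_dRight (g h x : G) (v : E) : dRight g (x * h) (dRight h x v) = dRight (h * g) x v :=
  tderiv_comp_apply (mdifferentiableAt_mul_right _ _) (mdifferentiableAt_mul_right _ _) rfl
    (fun z => mul_assoc z h g) v

theorem dLeft_dRight (g h x : G) (v : E) :
    dLeft g (x * h) (dRight h x v) = dRight h (g * x) (dLeft g x v) := by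
  have h1 := tderiv_comp_apply (k := fun z : G => g * z * h)
    (mdifferentiableAt_mul_left (E := E) g (x * h))
    (mdifferentiableAt_mul_right h x) rfl (fun z => (mul_assoc g z h).symm) v
  have h2 := tderiv_comp_apply (k := fun z : G => g * z * h)
    (mdifferentiableAt_mul_right (E := E) h (g * x))
    (mdifferentiableAt_mul_left g x) rfl (fun z => rfl) v
  exact h1.trans h2.symm

theorem dRight_inv_cancel (g x : G) (v : E) : dRight g⁻¹ (x * g) (dRight g x v) = v := by
  rw [dRight_dRight, mul_inv_cancel, dRight_one]

theorem dLeft_inv_cancel (g x : G) (v : E) : dLeft g⁻¹ (g * x) (dLeft g x v) = v := by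
  rw [dLeft_dLeft, inv_mul_cancel, dLeft_one]

theorem dLeft_cancel_inv (g : G) (v : E) : dLeft g 1 (dLeft g⁻¹ g v) = v := by
  simpa using dLeft_inv_cancel g⁻¹ g v

theorem dRight_cancel_inv (g : G) (v : E) : dRight g 1 (dRight g⁻¹ g v) = v := by
  simpa using dRight_inv_cancel g⁻¹ g v

theorem adjoint_eq (g : G) (v : E) : adjoint g v = dRight g⁻¹ g (dLeft g 1 v) :=
  (tderiv_comp_apply (mdifferentiableAt_mul_right _ _) (mdifferentiableAt_mul_left _ _)
    (mul_one g) (fun _ => rfl) v).symm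

theorem dRight_adjoint (g : G) (v : E) : dRight g 1 (adjoint g v) = dLeft g 1 v := by
  rw [adjoint_eq, dRight_cancel_inv]

theorem adjoint_mul (g h : G) (v : E) : adjoint (g * h) v = adjoint g (adjoint h v) :=
  (tderiv_comp_apply (k := fun z : G => g * h * z * (g * h)⁻¹) (mdifferentiableAt_conj _ _)
    (mdifferentiableAt_conj _ _) (by simp)
    (fun z => by simp only [mul_inv_rev, mul_assoc]) v).symm

theorem adjoint_one (v : E) : adjoint (1 : G) v = v := by
  rw [adjoint_eq, inv_one, dRight_one, dLeft_one]

theorem adjoint_inv_adjoint (g : G) (v : E) : adjoint g⁻¹ (adjoint g v) = v := by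
  rw [← adjoint_mul, inv_mul_cancel, adjoint_one]

theorem adjoint_adjoint_inv (g : G) (v : E) : adjoint g (adjoint g⁻¹ v) = v := by
  rw [← adjoint_mul, mul_inv_cancel, adjoint_one]

theorem tderiv_hom_dLeft {f : G →* G'} (hf : ContMDiff 𝓘(ℝ, E) 𝓘(ℝ, E') ∞ f)
    (g x : G) (v : E) :
    tderiv E E' f (g * x) (dLeft g x v) = dLeft (f g) (f x) (tderiv E E' f x v) := by
  have h1 := tderiv_comp_apply (k := fun z => f g * f z) (hf.mdifferentiable (by simp) (g * x))
    (mdifferentiableAt_mul_left g x) rfl (fun z => map_mul f g z) v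
  have h2 := tderiv_comp_apply (k := fun z => f g * f z)
    (mdifferentiableAt_mul_left (E := E') (f g) (f x))
    (hf.mdifferentiable (by simp) x) rfl (fun z => rfl) v
  exact h1.trans h2.symm

theorem tderiv_hom_dRight {f : G →* G'} (hf : ContMDiff 𝓘(ℝ, E) 𝓘(ℝ, E') ∞ f)
    (g x : G) (v : E) :
    tderiv E E' f (x * g) (dRight g x v) = dRight (f g) (f x) (tderiv E E' f x v) := by
  have h1 := tderiv_comp_apply (k := fun z => f z * f g) (hf.mdifferentiable (by simp) (x * g))
    (mdifferentiableAt_mul_right g x) rfl (fun z => map_mul f z g) v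
  have h2 := tderiv_comp_apply (k := fun z => f z * f g)
    (mdifferentiableAt_mul_right (E := E') (f g) (f x))
    (hf.mdifferentiable (by simp) x) rfl (fun z => rfl) v
  exact h1.trans h2.symm

theorem tderiv_hom_adjoint {f : G →* G'} (hf : ContMDiff 𝓘(ℝ, E) 𝓘(ℝ, E') ∞ f)
    (g : G) (v : E) :
    tderiv E E' f 1 (adjoint g v) = adjoint (f g) (tderiv E E' f 1 v) := by
  have h1 := tderiv_comp_apply (k := fun z => f g * f z * (f g)⁻¹)
    (hf.mdifferentiable (by simp) 1) (mdifferentiableAt_conj g 1) (by simp)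
    (fun z => by simp) v
  have h2 := tderiv_comp_apply (k := fun z => f g * f z * (f g)⁻¹)
    (mdifferentiableAt_conj (E := E') (f g) 1)
    (hf.mdifferentiable (by simp) 1) (map_one f) (fun z => rfl) v
  exact h1.trans h2.symm

/-- The differential of a homomorphism of Lie groups at `1` preserves the Lie brackets. -/
theorem tderiv_hom_lieBracket {f : G →* G'} (hf : ContMDiff 𝓘(ℝ, E) 𝓘(ℝ, E') ∞ f)
    (v w : E) :
    tderiv E E' f 1 (lieBracket E G v w) =
      lieBracket E' G' (tderiv E E' f 1 v) (tderiv E E' f 1 w) := by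
  obtain ⟨L, hL, hLb⟩ := exists_hasMFDerivAt_adjoint (G := G) w
  obtain ⟨L', hL', hLb'⟩ := exists_hasMFDerivAt_adjoint (G := G') (tderiv E E' f 1 w)
  have hf1 := hasMFDerivAt_tderiv (hf.mdifferentiable (by simp) 1)
  have h1 := ((tderiv E E' f 1).hasFDerivAt (x := adjoint (1 : G) w)).hasMFDerivAt.comp (1 : G) hL
  rw [← map_one f] at hL'
  have h2 := hL'.comp (1 : G) hf1
  have h3 : (fun g' => adjoint g' (tderiv E E' f 1 w)) ∘ f =
      tderiv E E' f 1 ∘ fun g => adjoint g w :=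
    funext fun g => (tderiv_hom_adjoint hf g w).symm
  rw [h3] at h2
  have h4 := congrArg (fun L : E →L[ℝ] E' => L v) (hasMFDerivAt_unique h1 h2)
  rw [← hLb, ← hLb']
  exact h4

/-- The Leibniz rule for the product of two maps with values in a Lie group. -/
theorem hasMFDerivAt_mul {X F : Type*} [NormedAddCommGroup F] [NormedSpace ℝ F]
    [TopologicalSpace X] {I : ModelWithCorners ℝ F X} {M : Type*} [TopologicalSpace M]
    [ChartedSpace X M] {a b : M → G} {x : M} {a' b' : F →L[ℝ] E}
    (ha : HasMFDerivAt I 𝓘(ℝ, E) a x a') (hb : HasMFDerivAt I 𝓘(ℝ, E) b x b') :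
    HasMFDerivAt I 𝓘(ℝ, E) (fun z => a z * b z) x
      ((dRight (b x) (a x)).comp a' + (dLeft (a x) (b x)).comp b' : F →L[ℝ] E) := by
  have hmul : MDifferentiableAt (𝓘(ℝ, E).prod 𝓘(ℝ, E)) 𝓘(ℝ, E) (fun p : G × G => p.1 * p.2)
      (a x, b x) := (contMDiff_mul 𝓘(ℝ, E) ∞).mdifferentiable (by simp) _
  have h := HasMFDerivAt.comp x (f := fun z => (a z, b z)) hmul.hasMFDerivAt (ha.prodMk hb)
  refine h.congr_mfderiv (ContinuousLinearMap.ext fun v => ?_)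
  exact mfderiv_prod_eq_add_apply hmul (v := (a' v, b' v))

theorem hasMFDerivAt_inv_one :
    HasMFDerivAt 𝓘(ℝ, E) 𝓘(ℝ, E) (fun x : G => x⁻¹) 1 (-ContinuousLinearMap.id ℝ E) := by
  have hinv := hasMFDerivAt_tderiv ((contMDiff_inv 𝓘(ℝ, E) ∞).mdifferentiable (by simp) (1 : G))
  have h := hasMFDerivAt_mul (hasMFDerivAt_id (I := 𝓘(ℝ, E)) (1 : G)) hinv
  have h0 : HasMFDerivAt 𝓘(ℝ, E) 𝓘(ℝ, E) (fun z : G => id z * z⁻¹) 1 (0 : E →L[ℝ] E) := by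
    have h1 : (fun z : G => id z * z⁻¹) = fun _ => 1 := funext fun z => mul_inv_cancel z
    rw [h1]
    exact hasMFDerivAt_const (1 : G) (1 : G)
  have h1 : tderiv E E (fun x : G => x⁻¹) 1 = -ContinuousLinearMap.id ℝ E := by
    ext v
    have h2 := congrArg (fun L : E →L[ℝ] E => L v) (hasMFDerivAt_unique h h0)
    have h3 : dRight (1 : G)⁻¹ 1 v + dLeft (1 : G) (1 : G)⁻¹
        (tderiv E E (fun x : G => x⁻¹) 1 v) = 0 := h2
    rw [inv_one, dRight_one, dLeft_one] at h3
    exact eq_neg_of_add_eq_zero_right h3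
  rwa [h1] at hinv

end LieGroupDerivative

/-! ### One-parameter subgroups -/

section OneParameter
variable {E : Type*} [NormedAddCommGroup E] [NormedSpace ℝ E]
  {G : Type*} [TopologicalSpace G] [ChartedSpace E G] [Group G] [LieGroup 𝓘(ℝ, E) ∞ G]

/-- The left-invariant vector field of `ξ`. -/
def leftInvariantField (ξ : E) (g : G) : Tan E g := leftTr g ξ

theorem contMDiff_leftInvariantField (ξ : E) :
    ContMDiff 𝓘(ℝ, E) 𝓘(ℝ, E).tangent 1
      (fun g : G => (⟨g, leftInvariantField ξ g⟩ : TangentBundle 𝓘(ℝ, E) G)) := by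
  have : LieGroup 𝓘(ℝ, E) (minSmoothness ℝ 3) G := by
    rw [minSmoothness_of_isRCLikeNormedField]
    exact LieGroup.of_le (n := ∞) (WithTop.coe_le_coe.2 le_top)
  have h := contMDiff_mulInvariantVectorField (I := 𝓘(ℝ, E)) (G := G) ξ
  exact h.of_le (by rw [minSmoothness_of_isRCLikeNormedField]; norm_num)

theorem isMIntegralCurveOn_mul_left {γ : ℝ → G} {ξ : E} {s : Set ℝ}
    (h : IsMIntegralCurveOn (I := 𝓘(ℝ, E)) γ (leftInvariantField ξ) s) (g : G) :
    IsMIntegralCurveOn (I := 𝓘(ℝ, E)) (fun t => g * γ t) (leftInvariantField ξ) s := by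
  intro t ht
  have h1 := (mdifferentiableAt_mul_left (E := E) g (γ t)).hasMFDerivAt.comp_hasMFDerivWithinAt
    t (h t ht)
  refine h1.congr_mfderiv (ContinuousLinearMap.ext_ring ?_)
  have h2 := dLeft_dLeft g (γ t) 1 ξ
  rw [mul_one] at h2
  have h3 : dLeft (g * γ t) 1 ξ = dLeft g (γ t) (dLeft (γ t) 1 ξ) := h2.symm
  have h4 : (1 : ℝ) • dLeft (g * γ t) 1 ξ = dLeft g (γ t) ((1 : ℝ) • dLeft (γ t) 1 ξ) := by
    rw [one_smul, one_smul, h3]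
  exact h4.symm

/-- Every element of the Lie algebra generates a one-parameter subgroup: left translations move a
local integral curve through the unit to all points, so that the left-invariant field has integral
curves of a uniform length everywhere and is complete. -/
theorem exists_isOneParameterSubgroup [CompleteSpace E] [T2Space G] (ξ : E) :
    ∃ γ : ℝ → G, IsOneParameterSubgroup γ ξ := by
  have : IsManifold 𝓘(ℝ, E) 1 G := IsManifold.of_le (n := ∞) (by simp)
  have hv := contMDiff_leftInvariantField (G := G) ξ
  obtain ⟨γ₀, h0, hγ₀⟩ := exists_isMIntegralCurveAt_of_contMDiffAt_boundaryless (t₀ := 0)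
    (hv.contMDiffAt (x := 1))
  obtain ⟨ε, hε, hγ₀⟩ := isMIntegralCurveAt_iff'.1 hγ₀
  rw [Real.ball_eq_Ioo, zero_sub, zero_add] at hγ₀
  obtain ⟨γ, hγ1, hγ⟩ := exists_isMIntegralCurve_of_isMIntegralCurveOn hv hε
    (fun g => ⟨fun t => g * γ₀ t, by simp [h0], isMIntegralCurveOn_mul_left hγ₀ g⟩) 1
  refine ⟨γ, hγ1, fun s t => ?_, hγ⟩
  have h1 : IsMIntegralCurve (I := 𝓘(ℝ, E)) (fun t => γ s * γ t) (leftInvariantField ξ) :=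
    isMIntegralCurve_iff_isMIntegralCurveOn.2
      (isMIntegralCurveOn_mul_left (isMIntegralCurve_iff_isMIntegralCurveOn.1 hγ) (γ s))
  have h2 : IsMIntegralCurve (I := 𝓘(ℝ, E)) (γ ∘ (· + s)) (leftInvariantField ξ) :=
    hγ.comp_add s
  have h3 := isMIntegralCurve_Ioo_eq_of_contMDiff_boundaryless (t₀ := 0) hv h2 h1
    (by simp [hγ1])
  have := congrFun h3 t
  rw [add_comm]
  exact this

end OneParameter

/-! ### Cocycles on a connected group -/

section Cocycle
variable {F : Type*} [NormedAddCommGroup F] [NormedSpace ℝ F]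
  {H : Type*} [TopologicalSpace H] [ChartedSpace F H] [Group H] [LieGroup 𝓘(ℝ, F) ∞ H]

/-- A family of functions on a connected Lie group with the cocycle property
`δ s (u v) = δ s u + δ (ρ u s) v` vanishes when all its differentials at `1` vanish: by the cocycle
property its differentials vanish everywhere. -/
theorem eq_zero_of_cocycle [ConnectedSpace H] {S : Type*} (δ : S → H → ℝ) (ρ : H → S → S)
    (hρ : ∀ s, ρ 1 s = s) (hδ : ∀ s u v, δ s (u * v) = δ s u + δ (ρ u s) v)
    (hd : ∀ s, HasMFDerivAt 𝓘(ℝ, F) 𝓘(ℝ, ℝ) (δ s) 1 (0 : F →L[ℝ] ℝ)) (s : S) (u : H) :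
    δ s u = 0 := by
  have : IsManifold 𝓘(ℝ, F) 1 H := IsManifold.of_le (n := ∞) (by simp)
  have h1 : δ s 1 = 0 := by
    have h := hδ s 1 1
    rw [one_mul, hρ] at h
    linarith
  rw [← h1]
  refine eq_of_hasMFDerivAt_zero (I := 𝓘(ℝ, F)) (fun w => ?_) u 1
  have h2 : δ s = (fun r : ℝ => δ s w + r) ∘ (δ (ρ w s) ∘ fun z => w⁻¹ * z) := by
    funext z
    rw [Function.comp_apply, Function.comp_apply, ← hδ, mul_inv_cancel_left]
  have h3 : HasMFDerivAt 𝓘(ℝ, F) 𝓘(ℝ, ℝ) (δ (ρ w s)) (w⁻¹ * w) (0 : F →L[ℝ] ℝ) := by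
    rw [inv_mul_cancel]; exact hd _
  have h4 := h3.comp w (hasMFDerivAt_tderiv (mdifferentiableAt_mul_left (E := F) w⁻¹ w))
  have h5 : HasMFDerivAt 𝓘(ℝ, ℝ) 𝓘(ℝ, ℝ) (fun r : ℝ => δ s w + r) (δ (ρ w s) (w⁻¹ * w))
    (ContinuousLinearMap.id ℝ ℝ) := ((hasFDerivAt_id _).const_add _).hasMFDerivAt
  have h6 := h5.comp w h4
  rw [← h2] at h6
  refine h6.congr_mfderiv ?_
  ext v
  rfl

end Cocycle

section Bracket
variable {E : Type*} [NormedAddCommGroup E] [NormedSpace ℝ E]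
  {G : Type*} [TopologicalSpace G] [ChartedSpace E G] [Group G] [LieGroup 𝓘(ℝ, E) ∞ G]

theorem lieBracket_add_left (v v' w : E) :
    lieBracket E G (v + v') w = lieBracket E G v w + lieBracket E G v' w := by
  obtain ⟨L, -, hL⟩ := exists_hasMFDerivAt_adjoint (G := G) w
  simp only [← hL, map_add]

theorem lieBracket_add_right (v w w' : E) :
    lieBracket E G v (w + w') = lieBracket E G v w + lieBracket E G v w' := by
  rw [lieBracket_swap, lieBracket_add_left, neg_add, ← lieBracket_swap, ← lieBracket_swap]

end Bracket

/-! ### The Lie algebra of the double -/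

namespace GroupDouble

variable {E F V : Type*}
  [NormedAddCommGroup E] [NormedSpace ℝ E]
  [NormedAddCommGroup F] [NormedSpace ℝ F]
  [NormedAddCommGroup V] [NormedSpace ℝ V]
  {G H D : Type*}
  [TopologicalSpace G] [ChartedSpace E G] [Group G]
  [TopologicalSpace H] [ChartedSpace F H] [Group H]
  [TopologicalSpace D] [ChartedSpace V D] [Group D]
  {ΛG : TensorField E G} {ΛH : TensorField F H} (P : GroupDouble ΛG ΛH V D)

/-- The inclusion of `Lie G` in `Lie D`, as a map of the model spaces. -/
def di : E →L[ℝ] V := tderiv E V P.i 1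

/-- The inclusion of `Lie H` in `Lie D`, as a map of the model spaces. -/
def dj : F →L[ℝ] V := tderiv F V P.j 1

/-- The scalar product of the double, on the model space. -/
def pairing : V →ₗ[ℝ] V →ₗ[ℝ] ℝ := P.form

/-- The projection onto `Lie H`, on the model space. -/
def prH : V →ₗ[ℝ] V := P.projH

/-- The projection onto `Lie G`, on the model space. -/
def prG : V →ₗ[ℝ] V := P.projG

theorem pairing_symm (a b : V) : P.pairing a b = P.pairing b a := P.form_symm a b

theorem pairing_di_di (x x' : E) : P.pairing (P.di x) (P.di x') = 0 := P.isotropic_G x x'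

theorem pairing_dj_dj (y y' : F) : P.pairing (P.dj y) (P.dj y') = 0 := P.isotropic_H y y'

theorem pairing_adjoint (d : D) (a b : V) :
    P.pairing (adjoint d a) (adjoint d b) = P.pairing a b := P.form_Ad d a b

theorem prH_dj (y : F) : P.prH (P.dj y) = P.dj y :=
  Submodule.projection_apply_of_mem_left P.isCompl.symm (LinearMap.mem_range_self _ y)

theorem prG_di (x : E) : P.prG (P.di x) = P.di x :=
  Submodule.projection_apply_of_mem_left P.isCompl (LinearMap.mem_range_self _ x)

theorem prG_add_prH (a : V) : P.prG a + P.prH a = a :=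
  Submodule.projection_add_projection_eq_self P.isCompl a

theorem prH_di (x : E) : P.prH (P.di x) = 0 := by
  have h := P.prG_add_prH (P.di x)
  rwa [prG_di, add_eq_left] at h

theorem exists_prG (a : V) : ∃ x, P.di x = P.prG a :=
  LinearMap.mem_range.1 (Submodule.projection_apply_mem P.isCompl a)

theorem exists_prH (a : V) : ∃ y, P.dj y = P.prH a :=
  LinearMap.mem_range.1 (Submodule.projection_apply_mem P.isCompl.symm a)

theorem exists_di_add_dj (a : V) : ∃ x y, P.di x + P.dj y = a := by
  obtain ⟨x, hx⟩ := P.exists_prG a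
  obtain ⟨y, hy⟩ := P.exists_prH a
  exact ⟨x, y, by rw [hx, hy, prG_add_prH]⟩

theorem di_injective : Function.Injective P.di := P.immersive_i

theorem dj_injective : Function.Injective P.dj := P.immersive_j

theorem di_add_dj_eq_zero {x : E} {y : F} (h : P.di x + P.dj y = 0) : x = 0 ∧ y = 0 := by
  have h1 := congrArg P.prH h
  rw [map_add, prH_di, prH_dj, zero_add, map_zero] at h1
  rw [h1, add_zero] at h
  exact ⟨P.di_injective (h.trans (map_zero _).symm), P.dj_injective (h1.trans (map_zero _).symm)⟩

theorem eq_of_pairing {a b : V} (h : ∀ c, P.pairing a c = P.pairing b c) : a = b := by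
  have h1 := P.form_nondegenerate.1 (a - b) (fun (c : V) => by
    have h2 : P.pairing (a - b) c = 0 := by rw [map_sub, LinearMap.sub_apply, h, sub_self]
    exact h2)
  exact sub_eq_zero.1 h1

section Lie
variable [LieGroup 𝓘(ℝ, V) ∞ D]

theorem pairing_adjoint_left (d : D) (a b : V) :
    P.pairing (adjoint d a) b = P.pairing a (adjoint d⁻¹ b) := by
  rw [← P.pairing_adjoint d a, adjoint_adjoint_inv]

theorem adjoint_di [LieGroup 𝓘(ℝ, E) ∞ G] (g : G) (x : E) :
    adjoint (P.i g) (P.di x) = P.di (adjoint g x) := (tderiv_hom_adjoint P.smooth_i g x).symm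

theorem adjoint_dj [LieGroup 𝓘(ℝ, F) ∞ H] (u : H) (y : F) :
    adjoint (P.j u) (P.dj y) = P.dj (adjoint u y) := (tderiv_hom_adjoint P.smooth_j u y).symm

theorem lieBracket_di [LieGroup 𝓘(ℝ, E) ∞ G] (x x' : E) :
    lieBracket V D (P.di x) (P.di x') = P.di (lieBracket E G x x') :=
  (tderiv_hom_lieBracket P.smooth_i x x').symm

theorem lieBracket_dj [LieGroup 𝓘(ℝ, F) ∞ H] (y y' : F) :
    lieBracket V D (P.dj y) (P.dj y') = P.dj (lieBracket F H y y') :=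
  (tderiv_hom_lieBracket P.smooth_j y y').symm

/-- The coboundary `u ↦ ⟨Ad_u pr_H Ad_u⁻¹ a - pr_H a, b⟩` on `H`, for `s = (a, b)` in
`Lie D × Lie D`, where `pr_H` is the projection of `Lie D` onto `Lie H`. -/
def coboundary (s : V × V) (u : H) : ℝ :=
  P.pairing (P.prH (adjoint (P.j u⁻¹) s.1)) (adjoint (P.j u⁻¹) s.2) - P.pairing (P.prH s.1) s.2

theorem coboundary_mul (s : V × V) (u v : H) : P.coboundary s (u * v) =
    P.coboundary s u + P.coboundary (adjoint (P.j u⁻¹) s.1, adjoint (P.j u⁻¹) s.2) v := by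
  simp only [coboundary, mul_inv_rev, map_mul, adjoint_mul]
  ring

variable [FiniteDimensional ℝ V]

/-- The infinitesimal form of the invariance of the scalar product. -/
theorem pairing_lieBracket (v a b : V) :
    P.pairing (lieBracket V D v a) b + P.pairing a (lieBracket V D v b) = 0 := by
  obtain ⟨L, hL, hLb⟩ := exists_hasMFDerivAt_adjoint (G := D) a
  obtain ⟨L', hL', hLb'⟩ := exists_hasMFDerivAt_adjoint (G := D) b
  have h := hasMFDerivAt_bilinear (c := P.pairing.toContinuousBilinearMap) hL hL'
  have h0 : (fun d : D => P.pairing.toContinuousBilinearMap (adjoint d a) (adjoint d b)) =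
      fun _ => P.pairing a b := funext fun d => P.pairing_adjoint d a b
  rw [h0] at h
  have h1 := congrArg (fun L : V →L[ℝ] ℝ => L v)
    (hasMFDerivAt_unique h (hasMFDerivAt_const (P.pairing a b) (1 : D)))
  have h2 : P.pairing (adjoint (1 : D) a) (L' v) + P.pairing (L v) (adjoint (1 : D) b) = 0 := h1
  rwa [adjoint_one, adjoint_one, hLb, hLb', add_comm] at h2

variable [LieGroup 𝓘(ℝ, F) ∞ H]

theorem hasMFDerivAt_coboundary (s : V × V) : ∃ L : F →L[ℝ] ℝ,
    HasMFDerivAt 𝓘(ℝ, F) 𝓘(ℝ, ℝ) (P.coboundary s) 1 L ∧ ∀ y,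
      L y = -(P.pairing (P.prH (lieBracket V D (P.dj y) s.1)) s.2 +
        P.pairing (P.prH s.1) (lieBracket V D (P.dj y) s.2)) := by
  have hj : HasMFDerivAt 𝓘(ℝ, F) 𝓘(ℝ, V) P.j (1 : H)⁻¹ P.dj := by
    rw [inv_one]; exact hasMFDerivAt_tderiv (P.smooth_j.mdifferentiable (by simp) 1)
  have hji := hj.comp (1 : H) hasMFDerivAt_inv_one
  have key (a : V) : ∃ L : F →L[ℝ] V,
      HasMFDerivAt 𝓘(ℝ, F) 𝓘(ℝ, V) (fun u : H => adjoint (P.j u⁻¹) a) 1 L ∧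
        ∀ y, L y = -lieBracket V D (P.dj y) a := by
    obtain ⟨L, hL, hLb⟩ := exists_hasMFDerivAt_adjoint (G := D) a
    have hL1 : HasMFDerivAt 𝓘(ℝ, V) 𝓘(ℝ, V) (fun d : D => adjoint d a) (P.j (1 : H)⁻¹) L := by
      rwa [inv_one, map_one]
    refine ⟨_, hL1.comp (1 : H) hji, fun y => ?_⟩
    have h1 : L (P.dj (-y)) = -lieBracket V D (P.dj y) a := by
      rw [map_neg, map_neg, hLb]
    exact h1
  obtain ⟨L₁, h1, h1'⟩ := key s.1
  obtain ⟨L₂, h2, h2'⟩ := key s.2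
  have h := hasMFDerivAt_bilinear
    (c := (P.pairing.comp P.prH).toContinuousBilinearMap) h1 h2
  have hsub : HasMFDerivAt 𝓘(ℝ, ℝ) 𝓘(ℝ, ℝ) (fun r : ℝ => r - P.pairing (P.prH s.1) s.2)
      (P.pairing (P.prH (adjoint (P.j (1 : H)⁻¹) s.1)) (adjoint (P.j (1 : H)⁻¹) s.2))
      (ContinuousLinearMap.id ℝ ℝ) := ((hasFDerivAt_id _).sub_const _).hasMFDerivAt
  refine ⟨_, HasMFDerivAt.comp (1 : H) hsub h, fun y => ?_⟩
  have h3 : P.pairing (P.prH (adjoint (P.j (1 : H)⁻¹) s.1)) (L₂ y) +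
      P.pairing (P.prH (L₁ y)) (adjoint (P.j (1 : H)⁻¹) s.2) =
      -(P.pairing (P.prH (lieBracket V D (P.dj y) s.1)) s.2 +
        P.pairing (P.prH s.1) (lieBracket V D (P.dj y) s.2)) := by
    rw [h1', h2', inv_one, map_one, adjoint_one, adjoint_one]
    simp only [map_neg, LinearMap.neg_apply]
    ring
  exact h3

/-- The derivative of the coboundary at the unit is, up to the sign, the Lie bracket of the parts
in `Lie G`. -/
theorem deriv_coboundary [LieGroup 𝓘(ℝ, E) ∞ G] (x x' : E) (y y' z : F) :
    P.pairing (P.prH (lieBracket V D (P.dj z) (P.di x + P.dj y))) (P.di x' + P.dj y') +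
      P.pairing (P.prH (P.di x + P.dj y)) (lieBracket V D (P.dj z) (P.di x' + P.dj y')) =
    P.pairing (P.di (lieBracket E G x x')) (P.dj z) := by
  have h1 (a : V) : P.pairing (P.prH a) (P.di x' + P.dj y') = P.pairing a (P.di x') := by
    obtain ⟨x₁, y₁, rfl⟩ := P.exists_di_add_dj a
    simp only [map_add, prH_di, prH_dj, zero_add, LinearMap.add_apply, pairing_di_di,
      pairing_dj_dj, add_zero]
  rw [h1, map_add P.prH, prH_di, prH_dj, zero_add, lieBracket_add_right, lieBracket_add_right,
    lieBracket_dj, lieBracket_dj]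
  simp only [map_add, LinearMap.add_apply, pairing_dj_dj, add_zero]
  -- the terms with `y` cancel by invariance
  have h2 := P.pairing_lieBracket (P.dj z) (P.dj y) (P.di x')
  rw [lieBracket_dj] at h2
  have h3 := P.pairing_lieBracket (P.di x) (P.dj z) (P.di x')
  rw [lieBracket_di, lieBracket_swap, map_neg, LinearMap.neg_apply,
    P.pairing_symm (P.dj z)] at h3
  linarith

end Lie

/-! ### The Poisson tensor of the dual group as a coboundary -/

section Coboundary

variable [FiniteDimensional ℝ F]

/-- The covector on `Lie H` given by the pairing with an element of `Lie D`. -/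
def covector (a : V) : F →L[ℝ] ℝ :=
  ((P.pairing a).comp P.dj.toLinearMap).toContinuousLinearMap

theorem covector_apply (a : V) (y : F) : P.covector a y = P.pairing a (P.dj y) := rfl

/-- The tensor `Λ_H`, trivialized by right translations, as a function of two elements of `Lie D`
that stand for the covectors on `Lie H` they define. -/
def dualTensor (s : V × V) (u : H) : ℝ := rightTriv ΛH (P.covector s.1) (P.covector s.2) u

variable [LieGroup 𝓘(ℝ, V) ∞ D] [LieGroup 𝓘(ℝ, F) ∞ H]

theorem covector_adjoint (u : H) (a : V) (y : F) :
    P.covector (adjoint (P.j u⁻¹) a) y = P.covector a (adjoint u y) := by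
  rw [covector_apply, covector_apply, pairing_adjoint_left, ← map_inv, inv_inv, adjoint_dj]

theorem dualTensor_mul (hH : IsLiePoisson ΛH) (s : V × V) (u v : H) : P.dualTensor s (u * v) =
    P.dualTensor s u + P.dualTensor (adjoint (P.j u⁻¹) s.1, adjoint (P.j u⁻¹) s.2) v := by
  have h1 (a : V) : ((P.covector a : Cotan F (1 : H)).comp (rightTrInv (u * v))).comp
      (mfderiv 𝓘(ℝ, F) 𝓘(ℝ, F) (fun x : H => u * x) v) =
      (P.covector (adjoint (P.j u⁻¹) a) : Cotan F (1 : H)).comp (rightTrInv v) := by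
    refine ContinuousLinearMap.ext fun (w : F) => ?_
    have h : P.covector a (dRight (u * v)⁻¹ (u * v) (dLeft u v w)) =
        P.covector (adjoint (P.j u⁻¹) a) (dRight v⁻¹ v w) := by
      obtain ⟨z, rfl⟩ : ∃ z, dRight v 1 z = w := ⟨_, dRight_cancel_inv v w⟩
      have e1 := dLeft_dRight u v 1 z
      have e2 := dRight_inv_cancel v 1 z
      have e3 := dRight_dRight (u * v)⁻¹ v u (dLeft u 1 z)
      rw [one_mul, mul_one] at e1
      rw [one_mul] at e2
      rw [mul_inv_rev, mul_inv_cancel_left, ← adjoint_eq] at e3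
      rw [covector_adjoint, e2, e1, mul_inv_rev, e3]
    exact h
  have h2 (a : V) : ((P.covector a : Cotan F (1 : H)).comp (rightTrInv (u * v))).comp
      (mfderiv 𝓘(ℝ, F) 𝓘(ℝ, F) (fun x : H => x * v) u) =
      (P.covector a : Cotan F (1 : H)).comp (rightTrInv u) := by
    refine ContinuousLinearMap.ext fun (w : F) => ?_
    have h : P.covector a (dRight (u * v)⁻¹ (u * v) (dRight v u w)) =
        P.covector a (dRight u⁻¹ u w) := by
      rw [dRight_dRight, mul_inv_rev, mul_inv_cancel_left]
    exact h
  have h := hH.multiplicative u v ((P.covector s.1 : Cotan F (1 : H)).comp (rightTrInv (u * v)))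
    ((P.covector s.2 : Cotan F (1 : H)).comp (rightTrInv (u * v)))
  rw [h1, h1, h2, h2] at h
  exact h.trans (add_comm _ _)

variable [LieGroup 𝓘(ℝ, E) ∞ G] [FiniteDimensional ℝ V] [ConnectedSpace H]

/-- On a connected group a multiplicative tensor is determined by its linearization at the unit;
here it is the negative of the coboundary of the projection of `Lie D` onto `Lie H`. -/
theorem dualTensor_eq (hH : IsLiePoisson ΛH) (s : V × V) (u : H) :
    P.dualTensor s u + P.coboundary s u = 0 := by
  refine eq_zero_of_cocycle (F := F) (S := V × V) (fun s u => P.dualTensor s u + P.coboundary s u)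
    (fun u s => (adjoint (P.j u⁻¹) s.1, adjoint (P.j u⁻¹) s.2)) (fun s => ?_)
    (fun s u v => ?_) (fun s => ?_) s u
  · simp [adjoint_one]
  · rw [P.dualTensor_mul hH, P.coboundary_mul]; ring
  · obtain ⟨L, hL, hLy⟩ := P.hasMFDerivAt_coboundary s
    have hΛ : HasMFDerivAt 𝓘(ℝ, F) 𝓘(ℝ, ℝ) (P.dualTensor s) 1 (tderiv F ℝ (P.dualTensor s) 1) :=
      hasMFDerivAt_tderiv ((hH.smooth _ _).mdifferentiable (by simp) 1)
    have hadd : HasMFDerivAt 𝓘(ℝ, F) 𝓘(ℝ, ℝ) (fun u => P.dualTensor s u + P.coboundary s u) 1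
      (tderiv F ℝ (P.dualTensor s) 1 + L : F →L[ℝ] ℝ) := hΛ.add hL
    refine hadd.congr_mfderiv (ContinuousLinearMap.ext fun (z : F) => ?_)
    obtain ⟨x, y, hx⟩ := P.exists_di_add_dj s.1
    obtain ⟨x', y', hx'⟩ := P.exists_di_add_dj s.2
    have hcov (x : E) (y z : F) : P.covector (P.di x + P.dj y) z =
        P.pairing (P.di x) (P.dj z) := by
      rw [covector_apply, map_add, LinearMap.add_apply, pairing_dj_dj, add_zero]
    have h1 : tderiv F ℝ (P.dualTensor s) 1 z =
        P.pairing (P.di (lieBracket E G x x')) (P.dj z) :=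
      P.dual_H z x x' (P.covector s.1) (P.covector s.2)
        (fun w => hx ▸ hcov x y w) (fun w => hx' ▸ hcov x' y' w)
    have h2 : tderiv F ℝ (P.dualTensor s) 1 z + L z = 0 := by
      rw [h1, hLy, ← hx, ← hx', deriv_coboundary, add_neg_cancel]
    exact h2

/-- The Casimir condition in terms of the double: if `ξ` in `Lie G` represents the 1-form `η` at
`u`, then `Ad_u⁻¹ ξ` lies in `Lie G`. -/
theorem prH_adjoint_eq_zero (hH : IsLiePoisson ΛH) {η : ∀ u : H, Cotan F u}
    (hη : IsCasimir ΛH η) (u : H) {ξ : E}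
    (hξ : ∀ y : F, P.pairing (P.di ξ) (P.dj y) = η u (rightTr u y)) :
    P.prH (adjoint (P.j u⁻¹) (P.di ξ)) = 0 := by
  have h1 : (P.covector (P.di ξ) : Cotan F (1 : H)).comp (rightTrInv u) = η u := by
    refine ContinuousLinearMap.ext fun (w : F) => ?_
    have h : P.covector (P.di ξ) (dRight u⁻¹ u w) = (η u : F →L[ℝ] ℝ) w := by
      obtain ⟨z, rfl⟩ : ∃ z, dRight u 1 z = w := ⟨_, dRight_cancel_inv u w⟩
      have e2 := dRight_inv_cancel u 1 z
      rw [one_mul] at e2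
      rw [e2]
      exact hξ z
    exact h
  refine P.eq_of_pairing fun c => ?_
  have h2 := P.dualTensor_eq hH (P.di ξ, adjoint (P.j u) c) u
  have h3 : P.dualTensor (P.di ξ, adjoint (P.j u) c) u = 0 := by
    change ((P.covector (adjoint (P.j u) c) : Cotan F (1 : H)).comp (rightTrInv u))
      (ΛH u ((P.covector (P.di ξ) : Cotan F (1 : H)).comp (rightTrInv u))) = 0
    rw [h1, hη u, map_zero]
  have h4 : adjoint (P.j u⁻¹) (adjoint (P.j u) c) = c := by
    rw [map_inv, adjoint_inv_adjoint]
  rw [h3, coboundary, h4, prH_di, map_zero, LinearMap.zero_apply] at h2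
  rw [map_zero, LinearMap.zero_apply]
  linarith

end Coboundary

/-! ### The contraction with the tensor of the double -/

section Contraction

/-- The element of `Lie D` that represents the covector `α` through the scalar product. -/
def dualVec [FiniteDimensional ℝ V] (α : V →L[ℝ] ℝ) : V := P.dualIso (α : Cotan V (1 : D))

theorem pairing_dualVec [FiniteDimensional ℝ V] (α : V →L[ℝ] ℝ) (v : V) :
    P.pairing (P.dualVec α) v = α v := by
  have : FiniteDimensional ℝ (LieAlg V D) := inferInstanceAs (FiniteDimensional ℝ V)
  exact LinearMap.BilinForm.apply_toDual_symm_apply (hB := P.form_nondegenerate) (α.toLinearMap) v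

variable [LieGroup 𝓘(ℝ, V) ∞ D]

/-- The translate `v ↦ g v u` from `Lie D` to the tangent space of `D` at `g u`. -/
def translate (g : G) (u : H) (v : V) : V := dLeft (P.i g) (P.j u) (dRight (P.j u) 1 v)

theorem dLeft_eq_translate (g : G) (u : H) (v : V) :
    dLeft (P.i g * P.j u) 1 v = P.translate g u (adjoint (P.j u) v) := by
  have h := dLeft_dLeft (P.i g) (P.j u) 1 v
  rw [mul_one] at h
  rw [← h, translate, dRight_adjoint]

theorem dRight_eq_translate (g : G) (u : H) (v : V) :
    dRight (P.i g * P.j u) 1 v = P.translate g u (adjoint (P.i g)⁻¹ v) := by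
  obtain ⟨w, rfl⟩ : ∃ w, adjoint (P.i g) w = v := ⟨_, adjoint_adjoint_inv _ v⟩
  have h := dRight_dRight (P.j u) (P.i g) 1 (adjoint (P.i g) w)
  rw [one_mul] at h
  have h' := dLeft_dRight (P.i g) (P.j u) 1 w
  rw [one_mul, mul_one] at h'
  rw [← h, dRight_adjoint, adjoint_inv_adjoint, translate, h']

theorem translate_injective (g : G) (u : H) : Function.Injective (P.translate g u) := by
  intro v w h
  have h1 (v : V) : dRight (P.j u)⁻¹ (P.j u) (dLeft (P.i g)⁻¹ (P.i g * P.j u)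
      (P.translate g u v)) = v := by
    have h2 := dRight_inv_cancel (P.j u) 1 v
    rw [one_mul] at h2
    rw [translate, dLeft_inv_cancel, h2]
  rw [← h1 v, h, h1]

theorem translate_surjective (g : G) (u : H) : Function.Surjective (P.translate g u) := by
  intro w
  refine ⟨dRight (P.j u)⁻¹ (P.j u) (dLeft (P.i g)⁻¹ (P.i g * P.j u) w), ?_⟩
  have h := dLeft_dLeft (P.i g) (P.i g)⁻¹ (P.i g * P.j u) w
  rw [inv_mul_cancel_left, mul_inv_cancel, dLeft_one] at h
  rw [translate, dRight_cancel_inv, h]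

/-- The two halves of `Λ_D^+` contribute equally. The right-invariant half sees `Ad_g ξ`, which
always lies in `Lie G`, and the left-invariant half sees `Ad_u⁻¹ ξ`, which does so by the
hypothesis. -/
theorem lambdaPlus_eq [LieGroup 𝓘(ℝ, E) ∞ G] [FiniteDimensional ℝ V] {g : G} {u : H} {d : D} (hd : P.i g * P.j u = d) (θ : V →L[ℝ] ℝ) {ξ : E}
    (hθ : ∀ v, θ (P.translate g u v) = P.pairing (P.di ξ) v)
    (hξ : P.prH (adjoint (P.j u⁻¹) (P.di ξ)) = 0) :
    P.lambdaPlus d θ = P.translate g u (P.di ξ) := by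
  subst hd
  set d := P.i g * P.j u
  have h1 : P.dualVec (θ.comp (dLeft d 1)) = adjoint (P.j u⁻¹) (P.di ξ) := by
    refine P.eq_of_pairing fun c => ?_
    rw [pairing_dualVec, ContinuousLinearMap.comp_apply, P.dLeft_eq_translate, hθ,
      pairing_adjoint_left, map_inv, inv_inv]
  have h2 : P.dualVec (θ.comp (dRight d 1)) = P.di (adjoint g ξ) := by
    refine P.eq_of_pairing fun c => ?_
    rw [pairing_dualVec, ContinuousLinearMap.comp_apply, P.dRight_eq_translate, hθ, ← adjoint_di,
      pairing_adjoint_left]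
  have h3 : P.lambdaPlus d θ = (2⁻¹ : ℝ) •
      (dLeft d 1 (P.prG (P.dualVec (θ.comp (dLeft d 1))) -
        P.prH (P.dualVec (θ.comp (dLeft d 1)))) +
      dRight d 1 (P.prG (P.dualVec (θ.comp (dRight d 1))) -
        P.prH (P.dualVec (θ.comp (dRight d 1))))) := rfl
  have h4 := P.prG_add_prH (adjoint (P.j u⁻¹) (P.di ξ))
  rw [hξ, add_zero] at h4
  rw [h3, h1, h2, hξ, h4, prG_di, prH_di, sub_zero, sub_zero, P.dLeft_eq_translate,
    P.dRight_eq_translate, map_inv, adjoint_adjoint_inv, ← adjoint_di, adjoint_inv_adjoint,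
    ← two_smul ℝ, smul_smul, inv_mul_cancel₀ two_ne_zero, one_smul]

end Contraction

/-! ### The coordinates on a complete double -/

section Legendre

/-- The Legendre map represents `η` at `u`, trivialized by right translation. -/
theorem pairing_legendre {κ : Type*} [Fintype κ] [DecidableEq κ]
    (X : Module.Basis κ ℝ (LieAlg E G)) (Y : Module.Basis κ ℝ (LieAlg F H))
    (hXY : ∀ k l, P.form (lieMap E V P.i (X k)) (lieMap F V P.j (Y l)) = if k = l then 1 else 0)
    (η : ∀ u : H, Cotan F u) (u : H) (y : F) :
    P.pairing (P.di (legendre X Y η u)) (P.dj y) = η u (rightTr u y) := by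
  let α : LieAlg F H →ₗ[ℝ] ℝ :=
    (P.form (lieMap E V P.i (legendre X Y η u))).comp (lieMap F V P.j).toLinearMap
  let β : LieAlg F H →ₗ[ℝ] ℝ := ((η u).comp (rightTr u)).toLinearMap
  have h : α = β := by
    refine Y.ext fun l => ?_
    change P.form (lieMap E V P.i (legendre X Y η u)) (lieMap F V P.j (Y l)) = η u (rightTr u (Y l))
    rw [legendre, map_sum, map_sum, LinearMap.sum_apply]
    simp only [map_smul, LinearMap.smul_apply, hXY, smul_eq_mul, mul_ite, mul_one, mul_zero,
      Finset.sum_ite_eq', Finset.mem_univ, if_true]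
  exact congrArg (fun L : LieAlg F H →ₗ[ℝ] ℝ => L y) h

end Legendre

section Coordinates

variable {P} (hP : P.IsComplete)

theorem IsComplete.mulMap_coords (d : D) : P.mulMap (hP.coords d) = d :=
  (Equiv.ofBijective P.mulMap hP.bijective).apply_symm_apply d

theorem IsComplete.coords_mulMap (p : G × H) : hP.coords (P.mulMap p) = p :=
  (Equiv.ofBijective P.mulMap hP.bijective).symm_apply_apply p

theorem IsComplete.muG_mul_muH (d : D) : P.i (hP.muG d) * P.j (hP.muH d) = d := hP.mulMap_coords d

theorem IsComplete.muG_mul (g : G) (u : H) : hP.muG (P.i g * P.j u) = g :=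
  congrArg Prod.fst (hP.coords_mulMap (g, u))

theorem IsComplete.muH_mul (g : G) (u : H) : hP.muH (P.i g * P.j u) = u :=
  congrArg Prod.snd (hP.coords_mulMap (g, u))

end Coordinates

section Dynamics

variable [LieGroup 𝓘(ℝ, V) ∞ D]

/-- The differential of the group product `G × H → D` at `(g, u)`. -/
def mulDeriv (g : G) (u : H) : E × F →L[ℝ] V :=
  ((dRight (P.j u) (P.i g)).comp (tderiv E V P.i g)).comp (.fst ℝ E F) +
    ((dLeft (P.i g) (P.j u)).comp (tderiv F V P.j u)).comp (.snd ℝ E F)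

theorem hasMFDerivAt_mulMap (p : G × H) :
    HasMFDerivAt (𝓘(ℝ, E).prod 𝓘(ℝ, F)) 𝓘(ℝ, V) P.mulMap p (P.mulDeriv p.1 p.2) := by
  have h1 := (hasMFDerivAt_tderiv (P.smooth_i.mdifferentiable (by simp) p.1)).comp p
    (hasMFDerivAt_fst (I := 𝓘(ℝ, E)) (I' := 𝓘(ℝ, F)) _)
  have h2 := (hasMFDerivAt_tderiv (P.smooth_j.mdifferentiable (by simp) p.2)).comp p
    (hasMFDerivAt_snd (I := 𝓘(ℝ, E)) (I' := 𝓘(ℝ, F)) _)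
  exact hasMFDerivAt_mul (F := E × F) h1 h2

variable [LieGroup 𝓘(ℝ, E) ∞ G] [LieGroup 𝓘(ℝ, F) ∞ H]

theorem mulDeriv_apply (g : G) (u : H) (x : E) (y : F) :
    P.mulDeriv g u (dLeft g 1 x, dRight u 1 y) = P.translate g u (P.di x + P.dj y) := by
  have h1 := tderiv_hom_dLeft P.smooth_i g 1 x
  have h2 := tderiv_hom_dRight P.smooth_j u 1 y
  have h3 := dLeft_dRight (P.i g) (P.j u) 1 (P.di x)
  rw [mul_one, map_one] at h1
  rw [one_mul, map_one] at h2
  rw [one_mul, mul_one] at h3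
  have h4 : P.mulDeriv g u (dLeft g 1 x, dRight u 1 y) =
      dRight (P.j u) (P.i g) (tderiv E V P.i g (dLeft g 1 x)) +
        dLeft (P.i g) (P.j u) (tderiv F V P.j u (dRight u 1 y)) := rfl
  rw [h4, h1, h2, translate, map_add, map_add, h3]
  rfl

theorem mulDeriv_bijective (g : G) (u : H) : Function.Bijective (P.mulDeriv g u) := by
  have hrep (v : E × F) : ∃ x y, (dLeft g 1 x, dRight u 1 y) = v :=
    ⟨dLeft g⁻¹ g v.1, dRight u⁻¹ u v.2, by rw [dLeft_cancel_inv, dRight_cancel_inv]⟩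
  constructor
  · refine (injective_iff_map_eq_zero _).2 fun v hv => ?_
    obtain ⟨x, y, rfl⟩ := hrep v
    have h0 : P.translate g u 0 = 0 := by rw [translate, map_zero, map_zero]
    rw [mulDeriv_apply, ← h0] at hv
    obtain ⟨rfl, rfl⟩ := P.di_add_dj_eq_zero (P.translate_injective g u hv)
    rw [map_zero, map_zero, Prod.mk_zero_zero]
  · intro w
    obtain ⟨v, rfl⟩ := P.translate_surjective g u w
    obtain ⟨x, y, rfl⟩ := P.exists_di_add_dj v
    exact ⟨_, P.mulDeriv_apply g u x y⟩

variable {P} (hP : P.IsComplete) [FiniteDimensional ℝ E] [FiniteDimensional ℝ F]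

theorem IsComplete.contMDiff_coords :
    ContMDiff 𝓘(ℝ, V) (𝓘(ℝ, E).prod 𝓘(ℝ, F)) ∞ hP.coords := by
  have : CompleteSpace (E × F) := FiniteDimensional.complete ℝ _
  intro d
  set p := hP.coords d
  have hp : P.mulMap p = d := hP.mulMap_coords d
  have hsmooth : ContMDiff (𝓘(ℝ, E).prod 𝓘(ℝ, F)) 𝓘(ℝ, V) ∞ P.mulMap :=
    (P.smooth_i.comp contMDiff_fst).mul (P.smooth_j.comp contMDiff_snd)
  let L : (E × F) ≃L[ℝ] V :=
    (LinearEquiv.ofBijective (P.mulDeriv p.1 p.2).toLinearMap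
      (P.mulDeriv_bijective p.1 p.2)).toContinuousLinearEquiv
  obtain ⟨s, hs, hs'⟩ := exists_contMDiffAt_section hsmooth.contMDiffAt L
    (P.hasMFDerivAt_mulMap p)
  rw [hp] at hs hs'
  refine hs.congr_of_eventuallyEq (hs'.mono fun d' hd' => ?_)
  rw [← hd', hP.coords_mulMap, hd']

theorem IsComplete.contMDiff_muG : ContMDiff 𝓘(ℝ, V) 𝓘(ℝ, E) ∞ hP.muG :=
  contMDiff_fst.comp hP.contMDiff_coords

theorem IsComplete.contMDiff_muH : ContMDiff 𝓘(ℝ, V) 𝓘(ℝ, F) ∞ hP.muH :=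
  contMDiff_snd.comp hP.contMDiff_coords

theorem IsComplete.tderiv_muG_mulDeriv (d : D) (v : E × F) :
    tderiv V E hP.muG d (P.mulDeriv (hP.muG d) (hP.muH d) v) = v.1 := by
  have h := hasMFDerivAt_tderiv (hP.contMDiff_muG.mdifferentiable (by simp) d)
  have h1 : HasMFDerivAt 𝓘(ℝ, V) 𝓘(ℝ, E) hP.muG (P.mulMap (hP.coords d))
      (tderiv V E hP.muG d) := by rw [hP.mulMap_coords]; exact h
  have h2 := h1.comp _ (P.hasMFDerivAt_mulMap (hP.coords d))
  have h3 : hP.muG ∘ P.mulMap = Prod.fst := funext fun p => hP.muG_mul p.1 p.2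
  rw [h3] at h2
  exact congrArg (fun L : E × F →L[ℝ] E => L v)
    (hasMFDerivAt_unique h2 (hasMFDerivAt_fst (I := 𝓘(ℝ, E)) (I' := 𝓘(ℝ, F)) _))

theorem IsComplete.tderiv_muH_mulDeriv (d : D) (v : E × F) :
    tderiv V F hP.muH d (P.mulDeriv (hP.muG d) (hP.muH d) v) = v.2 := by
  have h := hasMFDerivAt_tderiv (hP.contMDiff_muH.mdifferentiable (by simp) d)
  have h1 : HasMFDerivAt 𝓘(ℝ, V) 𝓘(ℝ, F) hP.muH (P.mulMap (hP.coords d))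
      (tderiv V F hP.muH d) := by rw [hP.mulMap_coords]; exact h
  have h2 := h1.comp _ (P.hasMFDerivAt_mulMap (hP.coords d))
  have h3 : hP.muH ∘ P.mulMap = Prod.snd := funext fun p => hP.muH_mul p.1 p.2
  rw [h3] at h2
  exact congrArg (fun L : E × F →L[ℝ] F => L v)
    (hasMFDerivAt_unique h2 (hasMFDerivAt_snd (I := 𝓘(ℝ, E)) (I' := 𝓘(ℝ, F)) _))

/-- The equation of motion of a curve, read in the coordinates `(g, u)`. -/
theorem IsComplete.hasMFDerivAt_curve_iff (c : ℝ → D) (t : ℝ) (w : E) :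
    HasMFDerivAt 𝓘(ℝ, ℝ) 𝓘(ℝ, V) c t
        ((1 : ℝ →L[ℝ] ℝ).smulRight (P.mulDeriv (hP.muG (c t)) (hP.muH (c t)) (w, 0))) ↔
      HasMFDerivAt 𝓘(ℝ, ℝ) 𝓘(ℝ, F) (fun s => hP.muH (c s)) t
        (0 : ℝ →L[ℝ] F) ∧
      HasMFDerivAt 𝓘(ℝ, ℝ) 𝓘(ℝ, E) (fun s => hP.muG (c s)) t
        ((1 : ℝ →L[ℝ] ℝ).smulRight w) := by
  constructor
  · intro h
    have h1 := hasMFDerivAt_tderiv (hP.contMDiff_muG.mdifferentiable (by simp) (c t))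
    have h2 := hasMFDerivAt_tderiv (hP.contMDiff_muH.mdifferentiable (by simp) (c t))
    refine ⟨(h2.comp t h).congr_mfderiv (ContinuousLinearMap.ext fun (r : ℝ) => ?_),
      (h1.comp t h).congr_mfderiv (ContinuousLinearMap.ext fun (r : ℝ) => ?_)⟩
    · have h3 : tderiv V F hP.muH (c t) (r • P.mulDeriv (hP.muG (c t)) (hP.muH (c t)) (w, 0)) =
          0 := by rw [map_smul, hP.tderiv_muH_mulDeriv, smul_zero]
      exact h3
    · have h3 : tderiv V E hP.muG (c t) (r • P.mulDeriv (hP.muG (c t)) (hP.muH (c t)) (w, 0)) =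
          r • w := by rw [map_smul, hP.tderiv_muG_mulDeriv]
      exact h3
  · rintro ⟨hu, hg⟩
    have h := HasMFDerivAt.comp t (f := fun s => (hP.muG (c s), hP.muH (c s)))
      (P.hasMFDerivAt_mulMap _) (hg.prodMk hu)
    have h1 : P.mulMap ∘ (fun s => (hP.muG (c s), hP.muH (c s))) = c :=
      funext fun s => hP.muG_mul_muH (c s)
    rw [h1] at h
    refine h.congr_mfderiv (ContinuousLinearMap.ext fun (r : ℝ) => ?_)
    have h3 : P.mulDeriv (hP.muG (c t)) (hP.muH (c t)) (r • w, 0) =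
        r • P.mulDeriv (hP.muG (c t)) (hP.muH (c t)) (w, 0) := by
      rw [← map_smul, Prod.smul_mk, smul_zero]
    exact h3

variable [FiniteDimensional ℝ V] [ConnectedSpace H]

/-- The vector field `Γ_η` at `g u` is the image of `ξ^l(g)` under the differential of the group
product, where `ξ` in `Lie G` represents `η` at `u`. -/
theorem IsComplete.gammaField_eq (hH : IsLiePoisson ΛH) {η : ∀ u : H, Cotan F u}
    (hη : IsCasimir ΛH η) (d : D) {ξ : E}
    (hξ : ∀ y : F, P.pairing (P.di ξ) (P.dj y) = η (hP.muH d) (rightTr (hP.muH d) y)) :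
    hP.gammaField η d = P.mulDeriv (hP.muG d) (hP.muH d) (dLeft (hP.muG d) 1 ξ, 0) := by
  have h1 := P.mulDeriv_apply (hP.muG d) (hP.muH d) ξ 0
  rw [map_zero, map_zero, add_zero] at h1
  rw [h1]
  let ηd : F →L[ℝ] ℝ := η (hP.muH d)
  refine P.lambdaPlus_eq (hP.muG_mul_muH d) (ηd.comp (tderiv V F hP.muH d)) (fun v => ?_)
    (P.prH_adjoint_eq_zero hH hη _ hξ)
  obtain ⟨x, y, rfl⟩ := P.exists_di_add_dj v
  rw [← mulDeriv_apply, ContinuousLinearMap.comp_apply, hP.tderiv_muH_mulDeriv, map_add,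
    pairing_di_di, zero_add, hξ]
  rfl

end Dynamics

end GroupDouble

end PoissonDouble

end

/-! ### Integrability by quadratures -/

theorem theorem1
    {E F V : Type*}
    [NormedAddCommGroup E] [NormedSpace ℝ E] [FiniteDimensional ℝ E]
    [NormedAddCommGroup F] [NormedSpace ℝ F] [FiniteDimensional ℝ F]
    [NormedAddCommGroup V] [NormedSpace ℝ V] [FiniteDimensional ℝ V]
    {G H D : Type*}
    [TopologicalSpace G] [ChartedSpace E G] [Group G] [LieGroup 𝓘(ℝ, E) ∞ G] [T2Space G]
    [TopologicalSpace H] [ChartedSpace F H] [Group H] [LieGroup 𝓘(ℝ, F) ∞ H] [T2Space H]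
    [ConnectedSpace H]
    [TopologicalSpace D] [ChartedSpace V D] [Group D] [LieGroup 𝓘(ℝ, V) ∞ D] [T2Space D]
    (ΛG : TensorField E G) (hG : IsLiePoisson ΛG)
    (ΛH : TensorField F H) (hH : IsLiePoisson ΛH)
    (P : GroupDouble ΛG ΛH V D) (hP : P.IsComplete)
    (η : ∀ u : H, Cotan F u) (hη : IsCasimir ΛH η)
    {κ : Type*} [Fintype κ] [DecidableEq κ]
    (X : Module.Basis κ ℝ (LieAlg E G)) (Y : Module.Basis κ ℝ (LieAlg F H))
    (hXY : ∀ k l, P.form (lieMap E V P.i (X k)) (lieMap F V P.j (Y l)) = if k = l then 1 else 0) :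
    -- `(g, u)` are smooth coordinates on `D`
    (ContMDiff 𝓘(ℝ, V) 𝓘(ℝ, E) ∞ hP.muG ∧ ContMDiff 𝓘(ℝ, V) 𝓘(ℝ, F) ∞ hP.muH) ∧
    -- the components of `Γ_η` in these coordinates
    (∀ d : D,
      mfderiv 𝓘(ℝ, V) 𝓘(ℝ, F) hP.muH d (hP.gammaField η d) = 0 ∧
      mfderiv 𝓘(ℝ, V) 𝓘(ℝ, E) hP.muG d (hP.gammaField η d) =
        leftTr (hP.muG d) (legendre X Y η (hP.muH d))) ∧
    -- the equations of motion: `u' = 0` and `g' = g L_η(u)`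
    (∀ (c : ℝ → D) (t : ℝ),
      HasMFDerivAt 𝓘(ℝ, ℝ) 𝓘(ℝ, V) c t
          ((1 : ℝ →L[ℝ] ℝ).smulRight (hP.gammaField η (c t))) ↔
        HasMFDerivAt 𝓘(ℝ, ℝ) 𝓘(ℝ, F) (fun s => hP.muH (c s)) t 0 ∧
        HasMFDerivAt 𝓘(ℝ, ℝ) 𝓘(ℝ, E) (fun s => hP.muG (c s)) t
          ((1 : ℝ →L[ℝ] ℝ).smulRight
            (leftTr (hP.muG (c t)) (legendre X Y η (hP.muH (c t)))))) ∧
    -- on each level set of `u` the flow is `g ↦ g exp (t L_η(u))`: these are the integral curves,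
    -- they are defined for all times, and there are no others
    (∀ u : H, ∃ γ : ℝ → G, IsOneParameterSubgroup γ (legendre X Y η u) ∧
      ∀ g : G,
        IsMIntegralCurve (I := 𝓘(ℝ, V)) (fun t => P.i (g * γ t) * P.j u) (hP.gammaField η) ∧
        ∀ (a b : ℝ) (c : ℝ → D), a < 0 → 0 < b → c 0 = P.i g * P.j u →
          IsMIntegralCurveOn (I := 𝓘(ℝ, V)) c (hP.gammaField η) (Set.Ioo a b) →
          ∀ t ∈ Set.Ioo a b, c t = P.i (g * γ t) * P.j u) := by
  have hpair := P.pairing_legendre X Y hXY η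
  have hfield (d : D) := hP.gammaField_eq hH hη d (hpair (hP.muH d))
  have hcurve (c : ℝ → D) (t : ℝ) :
      HasMFDerivAt 𝓘(ℝ, ℝ) 𝓘(ℝ, V) c t
          ((1 : ℝ →L[ℝ] ℝ).smulRight (hP.gammaField η (c t))) ↔
        HasMFDerivAt 𝓘(ℝ, ℝ) 𝓘(ℝ, F) (fun s => hP.muH (c s)) t 0 ∧
        HasMFDerivAt 𝓘(ℝ, ℝ) 𝓘(ℝ, E) (fun s => hP.muG (c s)) t
          ((1 : ℝ →L[ℝ] ℝ).smulRight
            (leftTr (hP.muG (c t)) (legendre X Y η (hP.muH (c t))))) := by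
    have h := hP.hasMFDerivAt_curve_iff c t
      (dLeft (hP.muG (c t)) 1 (legendre X Y η (hP.muH (c t))))
    rw [← hfield] at h
    exact h
  refine ⟨⟨hP.contMDiff_muG, hP.contMDiff_muH⟩, fun d => ⟨?_, ?_⟩, hcurve, fun u => ?_⟩
  · rw [hfield]
    exact hP.tderiv_muH_mulDeriv d _
  · rw [hfield]
    exact hP.tderiv_muG_mulDeriv d _
  have : CompleteSpace E := FiniteDimensional.complete ℝ E
  have : IsManifold 𝓘(ℝ, E) 1 G := IsManifold.of_le (n := ∞) (by simp)
  have : IsManifold 𝓘(ℝ, F) 1 H := IsManifold.of_le (n := ∞) (by simp)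
  obtain ⟨γ, hγ⟩ := exists_isOneParameterSubgroup (E := E) (G := G) (legendre X Y η u)
  refine ⟨γ, hγ, fun g => ?_⟩
  have hgγ : IsMIntegralCurve (I := 𝓘(ℝ, E)) (fun t => g * γ t)
      (leftInvariantField (legendre X Y η u)) :=
    isMIntegralCurve_iff_isMIntegralCurveOn.2 (isMIntegralCurveOn_mul_left
      (isMIntegralCurve_iff_isMIntegralCurveOn.1 hγ.hasMFDerivAt) g)
  refine ⟨fun t => (hcurve _ t).2 ?_, ?_⟩
  · have key (f : ℝ → G) (hf : f = fun s => g * γ s) (k : ℝ → H) (hk : k = fun _ => u) :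
        HasMFDerivAt 𝓘(ℝ, ℝ) 𝓘(ℝ, F) k t 0 ∧
        HasMFDerivAt 𝓘(ℝ, ℝ) 𝓘(ℝ, E) f t
          ((1 : ℝ →L[ℝ] ℝ).smulRight (leftTr (f t) (legendre X Y η (k t)))) := by
      subst hf hk
      exact ⟨hasMFDerivAt_const u t, hgγ t⟩
    exact key _ (funext fun s => hP.muG_mul _ u) _ (funext fun s => hP.muH_mul _ u)
  intro a b c ha hb hc0 hc
  have h0 : (0 : ℝ) ∈ Set.Ioo a b := ⟨ha, hb⟩
  have hc' (t : ℝ) (ht : t ∈ Set.Ioo a b) :=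
    (hcurve c t).1 ((hc t ht).hasMFDerivAt (isOpen_Ioo.mem_nhds ht))
  -- the momentum is conserved: it is an integral curve of the zero field, as is a constant
  have hu : Set.EqOn (fun t => hP.muH (c t)) (fun _ => u) (Set.Ioo a b) := by
    refine isMIntegralCurveOn_Ioo_eqOn_of_contMDiff_boundaryless (I := 𝓘(ℝ, F)) (v := fun _ => 0)
      h0 (Bundle.contMDiff_zeroSection ℝ _) (fun t ht => ?_) (fun t ht => ?_)
      (by simp only [hc0, hP.muH_mul])
    · exact (hc' t ht).1.hasMFDerivWithinAt.congr_mfderiv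
        (ContinuousLinearMap.smulRight_zero _).symm
    · exact (hasMFDerivAt_const u t).hasMFDerivWithinAt.congr_mfderiv
        (ContinuousLinearMap.smulRight_zero _).symm
  have hg : Set.EqOn (fun t => hP.muG (c t)) (fun t => g * γ t) (Set.Ioo a b) := by
    refine isMIntegralCurveOn_Ioo_eqOn_of_contMDiff_boundaryless (I := 𝓘(ℝ, E))
      h0 (contMDiff_leftInvariantField (E := E) (legendre X Y η u)) (fun t ht => ?_)
      (hgγ.isMIntegralCurveOn _) (by simp only [hc0, hP.muG_mul, hγ.map_zero, mul_one])
    have h := (hc' t ht).2.hasMFDerivWithinAt (s := Set.Ioo a b)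
    have hut : hP.muH (c t) = u := hu ht
    rw [hut] at h
    exact h
  intro t ht
  have hut : hP.muH (c t) = u := hu ht
  have hgt : hP.muG (c t) = g * γ t := hg ht
  rw [← hgt, ← hut, hP.muG_mul_muH]
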